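/- Let $A\subset\mathbb Z^d$ be a finite set. Write $NA=\{a_1+\cdots+a_N : a_i\in A\}$ for the $N$-fold sumset ($0A=\{0\}$), $H(A)\subset\mathbb R^d$ for the convex hull of $A$, $\operatorname{ex}(H(A))\subset A$ for its set of extreme points, $NH(A)=\{Nx:x\in H(A)\}$, and $\Lambda_A$ for the subgroup of $\mathbb Z^d$ generated by $A$. Put $$C_A=\Big\{\sum_{a\in A}c_a a: c_a\in\mathbb R_{\ge 0}\Big\},\qquad \mathcal P(A)=\bigcup_{N\ge 1}NA,\qquad \mathcal E(A)=(C_A\cap\mathbb Z^d)\setminus\mathcal P(A).$$ Let $$\operatorname{Vol}^{\dagger,\max}(H(A))=\max_{a_0,\dots,a_d\in A}\big|\det(a_1-a_0,\dots,a_d-a_0)\big| ,$$ let $\operatorname{Vol}$ denote Lebesgue measure on $\mathbb R^d$, and let $$\kappa(A)=\max_F\frac{\max_{a}\operatorname{Vol}(F,a)}{\min_{a}\operatorname{Vol}(F,a)},$$ where $F$ runs over the facets (the $(d-1)$-dimensional faces) of $H(A)$, $a$ runs over $A\setminus F$, and $\operatorname{Vol}(F,a)$ is the volume of the convex hull of $F\cup\{a\}$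 (for $d=0$, where there are no facets, put $\kappa(A)=0$). **Theorem 1.5 (Improved structural threshold).** Suppose that $0\in\operatorname{ex}(H(A))$ and $\Lambda_A=\mathbb Z^d$. Then there is a least integer $N_{\mathrm{Str}}(A)\ge 0$ such that for every integer $N\ge N_{\mathrm{Str}}(A)$ $$NA=(NH(A)\cap\mathbb Z^d)\setminus\bigcup_{a\in\operatorname{ex}(H(A))}\big(aN-\mathcal E(a-A)\big),$$ and it satisfies both $$N_{\mathrm{Str}}(A)\le (d+1)\,\kappa(A)\Big(d!\operatorname{Vol}(H(A))+\big(|\operatorname{ex}(H(A))|-d-1\big)\operatorname{Vol}^{\dagger,\max}(H(A))\Big)$$ and $$N_{\mathrm{Str}}(A)\le (d+1)\,\kappa(A)\,\big(|A|-d-1\big)\operatorname{Vol}^{\dagger,\max}(H(A)).$$ -/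

import Mathlib

open scoped Pointwise

noncomputable section

namespace Sumset

variable {d : ℕ}

/-- The inclusion of `ℤ^d` into `ℝ^d`. -/
def toReal (v : Fin d → ℤ) : Fin d → ℝ := fun i => (v i : ℝ)

/-- The `N`-fold sumset `NA = {a_1 + ⋯ + a_N : a_i ∈ A}` (so `0A = {0}`). -/
def nfold (N : ℕ) (A : Finset (Fin d → ℤ)) : Set (Fin d → ℤ) :=
  {v | ∃ s : Fin N → (Fin d → ℤ), (∀ i, s i ∈ A) ∧ v = ∑ i, s i}

/-- The convex hull `H(A) ⊆ ℝ^d`. -/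
def hull (A : Finset (Fin d → ℤ)) : Set (Fin d → ℝ) :=
  convexHull ℝ (toReal '' (A : Set (Fin d → ℤ)))

open Classical in
/-- The set `ex(H(A))` of extreme points of `H(A)`, as a set of lattice points; all extreme points
of `H(A)` lie in `A`, see `image_ex` below. -/
def ex (A : Finset (Fin d → ℤ)) : Finset (Fin d → ℤ) :=
  A.filter fun a => toReal a ∈ (hull A).extremePoints ℝ

theorem mem_ex {A : Finset (Fin d → ℤ)} {a : Fin d → ℤ} :
    a ∈ ex A ↔ a ∈ A ∧ toReal a ∈ (hull A).extremePoints ℝ := by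
  classical
  simp [ex]

theorem image_ex (A : Finset (Fin d → ℤ)) :
    toReal '' (ex A : Set (Fin d → ℤ)) = (hull A).extremePoints ℝ := by
  ext x
  constructor
  · rintro ⟨a, ha, rfl⟩
    exact (mem_ex.1 ha).2
  · intro hx
    obtain ⟨a, ha, rfl⟩ := extremePoints_convexHull_subset hx
    exact ⟨a, mem_ex.2 ⟨ha, hx⟩, rfl⟩

/-- The cone `C_A` of all `∑ c_a a` with real coefficients `c_a ≥ 0`. -/
def cone (A : Finset (Fin d → ℤ)) : Set (Fin d → ℝ) :=
  {x | ∃ c : (Fin d → ℤ) → ℝ, (∀ a ∈ A, 0 ≤ c a) ∧ x = ∑ a ∈ A, c a • toReal a}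

/-- `P(A) = ⋃_{N ≥ 1} NA`. -/
def semigroup (A : Finset (Fin d → ℤ)) : Set (Fin d → ℤ) :=
  ⋃ N : ℕ, ⋃ _ : 1 ≤ N, nfold N A

/-- The exceptional set `E(A) = (C_A ∩ ℤ^d) \ P(A)`. -/
def exceptional (A : Finset (Fin d → ℤ)) : Set (Fin d → ℤ) :=
  {v | toReal v ∈ cone A} \ semigroup A

/-- The reflected translate `a - A`. -/
def reflect (a : Fin d → ℤ) (A : Finset (Fin d → ℤ)) : Finset (Fin d → ℤ) :=
  A.image fun b => a - b

/-- The structural equation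
`NA = (N H(A) ∩ ℤ^d) \ ⋃_{a ∈ ex(H(A))} (aN - E(a - A))`. -/
def StructureEq (A : Finset (Fin d → ℤ)) (N : ℕ) : Prop :=
  nfold N A =
    {v | toReal v ∈ (N : ℝ) • hull A} \
      ⋃ a ∈ ex A, (fun e => N • a - e) '' exceptional (reflect a A)

/-- The structural threshold: the least `M` such that the structural equation holds for all
`N ≥ M`. -/
def NStr (A : Finset (Fin d → ℤ)) : ℕ :=
  sInf {M : ℕ | ∀ N : ℕ, M ≤ N → StructureEq A N}

/-- The largest `|det(a_{i_1} - a_{i_0}, …, a_{i_d} - a_{i_0})|` over points of `A`. Tuples with a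
repeated entry are harmless, as their determinant vanishes. -/
def volDagMax (A : Finset (Fin d → ℤ)) : ℕ :=
  (Fintype.piFinset fun _ : Fin (d + 1) => A).sup fun p =>
    (Matrix.of fun i j : Fin d => p j.succ i - p 0 i).det.natAbs

/-- The volume of `H(A)`. -/
def vol (A : Finset (Fin d → ℤ)) : ℝ := (MeasureTheory.volume (hull A)).toReal

/-- `F` is a facet of `H(A)`: a nonempty (exposed) face of dimension `d - 1`. Faces of a polytope
are the same as exposed faces. -/
def IsFacet (A : Finset (Fin d → ℤ)) (F : Set (Fin d → ℝ)) : Prop :=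
  IsExposed ℝ (hull A) F ∧ F.Nonempty ∧ Module.finrank ℝ (vectorSpan ℝ F) + 1 = d

/-- `Vol(F, a)`: the volume of the convex hull of `F` and `a`. -/
def pyramidVol (F : Set (Fin d → ℝ)) (a : Fin d → ℤ) : ℝ :=
  (MeasureTheory.volume (convexHull ℝ (insert (toReal a) F))).toReal

/-- The values `Vol(F, a)` for `a ∈ A \ F`. -/
def pyramidVols (A : Finset (Fin d → ℤ)) (F : Set (Fin d → ℝ)) : Set ℝ :=
  pyramidVol F '' {a | a ∈ A ∧ toReal a ∉ F}

/-- `κ(A) = max_F (max_a Vol(F, a) / min_a Vol(F, a))`, with `F` ranging over the facets of `H(A)`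
and `a` over `A \ F`. -/
def kappa (A : Finset (Fin d → ℤ)) : ℝ :=
  sSup ((fun F => sSup (pyramidVols A F) / sInf (pyramidVols A F)) '' {F | IsFacet A F})

end Sumset

end

/-! Fix an extreme point a of H(A) and put B = a - A, which contains 0. If v lies in NH(A) and not
in aN - E(B), then e = Na - v is a sum of elements of B. Once e is a sum of at most N of them,
padding with zeros and reflecting back gives v ∈ NA; the other inclusion is formal. So the task is
to bound the length of a shortest representation of e over B (`HasShortSums`), for a suitable a.

Let E ⊆ B be such that E ∪ {0} has the same convex hull as B, and let D = `volDagMax A`, which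
bounds the determinants formed from E ∪ {0}. In a shortest representation the elements of E of
multiplicity at least D lie on one facet φ = 1 avoiding the origin (`exists_isVertex_of_card_min`):
otherwise Farkas' lemma and Cramer's rule give an integer relation with coefficients at most D that
shortens the representation. The length is φ(e) plus the sum of 1 - φ(b) over the terms b. Terms on
the facet contribute 0 to that sum and the others at most κ(A), because heights above a facet are
proportional to pyramid volumes (`one_sub_le_kappa`). The facet contains at least d elements of E,
so at most (|E| - d)(D - 1) terms from E miss it. Counting also the terms outside E bounds the
length by φ(e) + κ(A)K.

There are two choices of E. With E = B \ {0} no term lies outside E. With E the nonzero extreme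
points of B, the cone is cut into simplicial cells σ; pigeonhole modulo the lattice of σ leaves
fewer than |det σ| terms outside E per cell, and these determinants add up to at most d! Vol
(`exists_isShortest_filter_card_lt`).

Finally, by Carathéodory some extreme point a has weight at least 1/(d+1) in v/N, whence φ(e) ≤ N -
N/(d+1) (`exists_ex_heavy`), and N ≥ (d+1)κ(A)K suffices. -/

namespace Sumset

/-! ### Vertices of polyhedra, Farkas' lemma and generic weights -/

section LinearInequalities

variable {V ι : Type*} [AddCommGroup V] [Module ℝ V]

/-- The indices at which the inequality `φ (g i) ≤ ω i` is an equality. -/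
def tight (g : ι → V) (ω : ι → ℝ) (φ : V →ₗ[ℝ] ℝ) : Set ι := {i | φ (g i) = ω i}

/-- `φ` is a vertex of the polyhedron `{φ | ∀ i, φ (g i) ≤ ω i}`. -/
def IsVertex (g : ι → V) (ω : ι → ℝ) (φ : V →ₗ[ℝ] ℝ) : Prop :=
  (∀ i, φ (g i) ≤ ω i) ∧ Submodule.span ℝ (g '' tight g ω φ) = ⊤

/-- `ω` is generic for `g`: tight constraints are linearly independent. -/
def IsGeneric (g : ι → V) (ω : ι → ℝ) : Prop :=
  ∀ φ : V →ₗ[ℝ] ℝ, LinearIndependent ℝ fun i : tight g ω φ => g i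

/-- The ratio test of the simplex method: constraints with `θ (g i) ≤ 0` never block the ray, and
the least ratio among the others is where it stops. -/
theorem exists_tight_on_ray [Finite ι] {g : ι → V} {ω : ι → ℝ} {φ θ : V →ₗ[ℝ] ℝ}
    (hφ : ∀ i, φ (g i) ≤ ω i) (hθ : ∃ i, 0 < θ (g i)) :
    ∃ s : ℝ, 0 ≤ s ∧ (∀ i, (φ + s • θ) (g i) ≤ ω i) ∧
      ∃ i, 0 < θ (g i) ∧ (φ + s • θ) (g i) = ω i := by
  obtain ⟨j, hj, hmin⟩ := Set.exists_min_image {i | 0 < θ (g i)}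
    (fun i => (ω i - φ (g i)) / θ (g i)) (Set.toFinite _) hθ
  have hj' : 0 < θ (g j) := hj
  have hs : 0 ≤ (ω j - φ (g j)) / θ (g j) := div_nonneg (sub_nonneg.2 (hφ j)) hj'.le
  refine ⟨_, hs, fun i => ?_, j, hj', ?_⟩
  · simp only [LinearMap.add_apply, LinearMap.smul_apply, smul_eq_mul]
    rcases lt_or_ge 0 (θ (g i)) with hi | hi
    · have := (le_div_iff₀ hi).1 (hmin i hi)
      linarith
    · have := mul_nonpos_of_nonneg_of_nonpos hs hi
      linarith [hφ i]
  · simp only [LinearMap.add_apply, LinearMap.smul_apply, smul_eq_mul]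
    rw [div_mul_cancel₀ _ hj'.ne']
    ring

/-- While the tight vectors fail to span, a functional vanishing on them is a direction that keeps
them tight and eventually meets a new constraint. The number of slack constraints drops at each
move. -/
theorem exists_isVertex [FiniteDimensional ℝ V] [Finite ι] {g : ι → V} {ω : ι → ℝ}
    (hg : Submodule.span ℝ (Set.range g) = ⊤) (φ : V →ₗ[ℝ] ℝ) (hφ : ∀ i, φ (g i) ≤ ω i) :
    ∃ ψ, IsVertex g ω ψ ∧ tight g ω φ ⊆ tight g ω ψ := by
  induction hn : (tight g ω φ)ᶜ.ncard using Nat.strong_induction_on generalizing φ with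
  | _ n ih =>
  by_cases hW : Submodule.span ℝ (g '' tight g ω φ) = ⊤
  · exact ⟨φ, ⟨hφ, hW⟩, subset_rfl⟩
  obtain ⟨i₀, hi₀⟩ : ∃ i, g i ∉ Submodule.span ℝ (g '' tight g ω φ) := by
    by_contra! h
    refine hW (top_le_iff.1 ?_)
    rw [← hg, Submodule.span_le]
    rintro _ ⟨i, rfl⟩
    exact h i
  obtain ⟨f, hf, hfW⟩ := Submodule.exists_dual_map_eq_bot_of_notMem hi₀ inferInstance
  have hfz : ∀ i ∈ tight g ω φ, f (g i) = 0 := fun i hi => by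
    have : f (g i) ∈ (Submodule.span ℝ (g '' tight g ω φ)).map f :=
      Submodule.mem_map_of_mem (Submodule.subset_span ⟨i, hi, rfl⟩)
    rwa [hfW, Submodule.mem_bot] at this
  have hθ : ∃ θ : V →ₗ[ℝ] ℝ, 0 < θ (g i₀) ∧ ∀ i ∈ tight g ω φ, θ (g i) = 0 := by
    -- Scaling `f` by its own value at `g i₀` makes that value positive, so the ray is blocked.
    refine ⟨f (g i₀) • f, ?_, fun i hi => ?_⟩
    · simpa using mul_self_pos.2 hf
    · simp [hfz i hi]
  obtain ⟨θ, hθ₀, hθz⟩ := hθ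
  obtain ⟨s, -, hfeas, j, hj, hjt⟩ := exists_tight_on_ray hφ ⟨i₀, hθ₀⟩
  have hsub : tight g ω φ ⊆ tight g ω (φ + s • θ) := fun i hi => by
    have h : φ (g i) = ω i := hi
    simp [tight, hθz i hi, h]
  have hjn : j ∉ tight g ω φ := fun h => hj.ne' (hθz j h)
  obtain ⟨ψ, h1, h2⟩ := ih _ (by
    rw [← hn]
    refine Set.ncard_lt_ncard ⟨Set.compl_subset_compl.2 hsub, fun h => ?_⟩ (Set.toFinite _)
    exact h hjn hjt) _ hfeas rfl
  exact ⟨ψ, h1, hsub.trans h2⟩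

theorem IsVertex.eq_of_tight_eq {g : ι → V} {ω : ι → ℝ} {φ ψ : V →ₗ[ℝ] ℝ}
    (hφ : IsVertex g ω φ) (h : tight g ω φ ⊆ tight g ω ψ) : φ = ψ := by
  refine LinearMap.ext_on hφ.2 ?_
  rintro _ ⟨i, hi, rfl⟩
  exact Eq.trans hi (h hi).symm

theorem finite_setOf_isVertex [Finite ι] (g : ι → V) (ω : ι → ℝ) :
    {φ | IsVertex g ω φ}.Finite :=
  Set.Finite.of_finite_image (Set.toFinite ((tight g ω) '' {φ | IsVertex g ω φ}))
    fun _ hφ _ _ h => IsVertex.eq_of_tight_eq hφ h.subset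

/-- A form of Farkas' lemma and Carathéodory's theorem: either `p` lies in the cone of the tight
set of a vertex, or it is separated from all `g i`. -/
theorem exists_isVertex_mem_cone_or_separated [FiniteDimensional ℝ V] [Finite ι] {g : ι → V}
    {ω : ι → ℝ} (hg : Submodule.span ℝ (Set.range g) = ⊤) (hω : IsGeneric g ω)
    (hω0 : ∀ i, 0 ≤ ω i) (p : V) :
    (∃ φ, IsVertex g ω φ ∧ ∃ b : Module.Basis (tight g ω φ) ℝ V, (∀ i, b i = g i) ∧
      ∀ i, 0 ≤ b.repr p i) ∨
    ∃ θ : V →ₗ[ℝ] ℝ, (∀ i, θ (g i) ≤ 0) ∧ 0 < θ p := by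
  obtain ⟨φ₀, hφ₀, -⟩ := exists_isVertex hg (0 : V →ₗ[ℝ] ℝ) (by simpa using hω0)
  -- The simplex method: take a vertex that maximises the value at `p`; genericity makes its tight
  -- vectors a basis.
  obtain ⟨φ, hφ, hmax⟩ := Set.exists_max_image {φ | IsVertex g ω φ} (fun φ => φ p)
    (finite_setOf_isVertex g ω) ⟨φ₀, hφ₀⟩
  have hφ' : IsVertex g ω φ := hφ
  have hspan : ⊤ ≤ Submodule.span ℝ (Set.range fun i : tight g ω φ => g i) := by
    rw [← hφ'.2, Set.image_eq_range]
  let b := Module.Basis.mk (hω φ) hspan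
  have hb : ∀ i, b i = g i := fun i => by simp [b]
  by_cases hp : ∀ i, 0 ≤ b.repr p i
  · exact Or.inl ⟨φ, hφ', b, hb, hp⟩
  right
  push Not at hp
  obtain ⟨i₀, hi₀⟩ := hp
  -- Along this direction the value at `p` grows and every tight constraint except `i₀` stays tight.
  -- Either the direction separates, or the ray ends at a better vertex.
  let θ : V →ₗ[ℝ] ℝ := -b.coord i₀
  have hθp : 0 < θ p := by simpa [θ] using hi₀
  by_cases hθ : ∀ i, θ (g i) ≤ 0
  · exact ⟨θ, hθ, hθp⟩
  exfalso
  push Not at hθ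
  have hθt : ∀ i : tight g ω φ, i ≠ i₀ → θ (g i) = 0 := fun i hi => by
    rw [← hb]
    simp [θ, hi]
  have hθ0 : θ (g i₀) = -1 := by
    rw [← hb]
    simp [θ]
  obtain ⟨s, hs0, hfeas, j, hj, hjt⟩ := exists_tight_on_ray hφ'.1 hθ
  have hjn : j ∉ tight g ω φ := fun h => by
    by_cases h' : (⟨j, h⟩ : tight g ω φ) = i₀
    · have : j = i₀ := congrArg Subtype.val h'
      rw [this, hθ0] at hj
      linarith
    · exact hj.ne' (hθt ⟨j, h⟩ h')
  have hs : 0 < s := by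
    rcases hs0.eq_or_lt with h | h
    · subst h
      exact absurd (show φ (g j) = ω j by simpa using hjt) hjn
    · exact h
  have hother : ∀ i : tight g ω φ, i ≠ i₀ → (i : ι) ∈ tight g ω (φ + s • θ) := fun i hi => by
    have h : φ (g i) = ω i := i.2
    simp [tight, hθt i hi, h]
  have hmem : ∀ i : tight g ω φ, i ≠ i₀ →
      b i ∈ Submodule.span ℝ (g '' tight g ω (φ + s • θ)) := fun i hi => by
    rw [hb]
    exact Submodule.subset_span ⟨i, hother i hi, rfl⟩
  have hi₀mem : b i₀ ∈ Submodule.span ℝ (g '' tight g ω (φ + s • θ)) := by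
    have hjm : g j ∈ Submodule.span ℝ (g '' tight g ω (φ + s • θ)) :=
      Submodule.subset_span ⟨j, hjt, rfl⟩
    -- The pivot: `g j` can replace `g i₀` in the basis.
    have hc : b.repr (g j) i₀ ≠ 0 := by
      have : 0 < -(b.repr (g j) i₀) := hj
      intro h
      rw [h] at this
      simp at this
    have := Fintype.ofFinite (tight g ω φ)
    classical
    rw [← b.sum_repr (g j), ← Finset.add_sum_erase _ _ (Finset.mem_univ i₀)] at hjm
    have h2 : ∑ i ∈ Finset.univ.erase i₀, b.repr (g j) i • b i ∈
        Submodule.span ℝ (g '' tight g ω (φ + s • θ)) :=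
      Submodule.sum_mem _ fun i hi => Submodule.smul_mem _ _ (hmem i (Finset.ne_of_mem_erase hi))
    have h3 := (Submodule.add_mem_iff_left _ h2).1 hjm
    exact (Submodule.smul_mem_iff _ hc).1 h3
  have hv : IsVertex g ω (φ + s • θ) := by
    refine ⟨hfeas, top_le_iff.1 ?_⟩
    rw [← b.span_eq, Submodule.span_le]
    rintro _ ⟨i, rfl⟩
    by_cases hi : i = i₀
    · exact hi ▸ hi₀mem
    · exact hmem i hi
  have h1 := hmax _ hv
  have h2 := mul_pos hs hθp
  simp only [LinearMap.add_apply, LinearMap.smul_apply, smul_eq_mul] at h1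
  linarith

/-- A real vector space is not a finite union of proper subspaces, here the kernels of the given
forms. -/
theorem exists_forall_sum_mul_ne_zero [Fintype ι] {κ : Type*} [Finite κ] (c : κ → ι → ℝ)
    (hc : ∀ k, c k ≠ 0) : ∃ η : ι → ℝ, ∀ k, ∑ i, c k i * η i ≠ 0 := by
  classical
  have := Fintype.ofFinite κ
  let f : κ → ((ι → ℝ) →ₗ[ℝ] ℝ) := fun k => ∑ i, c k i • LinearMap.proj i
  have hf : ∀ k η, f k η = ∑ i, c k i * η i := fun k η => by simp [f]
  have h := Subspace.biUnion_ne_univ_of_top_notMem (k := ℝ) (E := ι → ℝ)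
    (s := Finset.univ.image fun k => LinearMap.ker (f k)) (by
      simp only [Finset.mem_image, Finset.mem_univ, true_and, not_exists]
      intro k hk
      apply hc k
      ext i
      have : f k (Pi.single i 1) = 0 := by
        rw [← LinearMap.mem_ker, hk]
        trivial
      rw [hf] at this
      simpa [Pi.single_apply] using this)
  obtain ⟨η, hη⟩ := (Set.ne_univ_iff_exists_notMem _).1 h
  refine ⟨η, fun k hk => hη ?_⟩
  simp only [Finset.mem_image, Finset.mem_univ, true_and, Set.mem_iUnion, SetLike.mem_coe]
  exact ⟨_, ⟨k, rfl⟩, by rw [LinearMap.mem_ker, hf, hk]⟩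

/-- Weights `1 + t η` are generic for suitable `η` and all small `t > 0`. -/
theorem exists_eventually_isGeneric [Finite ι] (g : ι → V) :
    ∃ η : ι → ℝ, ∀ᶠ t in nhdsWithin (0 : ℝ) (Set.Ioi 0),
      IsGeneric g (fun i => 1 + t * η i) := by
  classical
  have := Fintype.ofFinite ι
  have key : ∀ S : {S : Finset ι // ¬ LinearIndependent ℝ fun i : S => g i},
      ∃ c : ι → ℝ, c ≠ 0 ∧ (∀ i, i ∉ S.1 → c i = 0) ∧ ∑ i, c i • g i = 0 := by
    rintro ⟨S, hS⟩
    rw [Fintype.not_linearIndependent_iff] at hS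
    obtain ⟨c, hc, i, hi⟩ := hS
    refine ⟨fun j => if h : j ∈ S then c ⟨j, h⟩ else 0, fun h => hi ?_, fun j hj => by simp [hj], ?_⟩
    · have := congrFun h i
      simpa using this
    · rw [← hc, ← Finset.sum_subset (Finset.subset_univ S), ← Finset.sum_attach S]
      · simp
      · intro x _ hx
        simp [hx]
  choose c hc0 hcS hcg using key
  obtain ⟨η, hη⟩ := exists_forall_sum_mul_ne_zero c hc0
  refine ⟨η, ?_⟩
  have hev : ∀ᶠ t in nhdsWithin (0 : ℝ) (Set.Ioi 0), ∀ S, ∑ i, c S i * (1 + t * η i) ≠ 0 := by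
    rw [Filter.eventually_all]
    intro S
    have heq : ∀ t : ℝ, ∑ i, c S i * (1 + t * η i) = ∑ i, c S i + t * ∑ i, c S i * η i := by
      intro t
      rw [Finset.mul_sum, ← Finset.sum_add_distrib]
      exact Finset.sum_congr rfl fun i _ => by ring
    simp_rw [heq]
    -- An affine function of `t` with nonzero slope: each dependent set excludes at most one `t`.
    have hfin : ({t : ℝ | ∑ i, c S i + t * ∑ i, c S i * η i = 0}).Subsingleton := by
      intro t ht u hu
      have ht' : ∑ i, c S i + t * ∑ i, c S i * η i = 0 := ht
      have hu' : ∑ i, c S i + u * ∑ i, c S i * η i = 0 := hu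
      exact mul_right_cancel₀ (hη S) (by linarith)
    exact (hfin.finite.eventually_cofinite_notMem).filter_mono
      ((nhdsWithin_mono _ fun x hx => ne_of_gt (Set.mem_Ioi.1 hx)).trans (nhdsNE_le_cofinite 0))
  filter_upwards [hev] with t ht φ
  by_contra hdep
  set T := tight g (fun i => 1 + t * η i) φ with hT
  have hdep' : ¬ LinearIndependent ℝ fun i : (Finset.univ.filter (· ∈ T) : Finset ι) => g i := by
    intro h
    apply hdep
    exact h.comp (fun i : T => ⟨i.1, by simp [i.2]⟩) fun a b hab => by
      apply Subtype.ext
      simpa using hab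
  apply ht ⟨_, hdep'⟩
  -- On a tight set, applying `φ` to the linear relation turns it into the forbidden relation
  -- between the weights.
  have h0 := congrArg φ (hcg ⟨_, hdep'⟩)
  rw [map_sum, map_zero] at h0
  rw [← h0]
  refine Finset.sum_congr rfl fun i _ => ?_
  by_cases hi : i ∈ T
  · have : φ (g i) = 1 + t * η i := hi
    rw [map_smul, this, smul_eq_mul]
  · rw [hcS _ i (by simpa using hi)]
    simp

theorem eventually_forall_one_add_mul_pos [Finite ι] (η : ι → ℝ) :
    ∀ᶠ t in nhdsWithin (0 : ℝ) (Set.Ioi 0), ∀ i, 0 < 1 + t * η i := by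
  rw [Filter.eventually_all]
  intro i
  have : ContinuousAt (fun t : ℝ => 1 + t * η i) 0 := by fun_prop
  exact (this.eventually (lt_mem_nhds (by simp))).filter_mono nhdsWithin_le_nhds

theorem exists_isGeneric_pos [Finite ι] (g : ι → V) :
    ∃ ω : ι → ℝ, IsGeneric g ω ∧ ∀ i, 0 ≤ ω i := by
  obtain ⟨η, hη⟩ := exists_eventually_isGeneric g
  obtain ⟨t, h1, h2⟩ := (hη.and (eventually_forall_one_add_mul_pos η)).exists
  exact ⟨_, h1, fun i => (h2 i).le⟩

/-- Farkas' lemma, with the basis supplied by Carathéodory's theorem. -/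
theorem exists_basis_cone_or_separated [FiniteDimensional ℝ V] [Finite ι] {g : ι → V}
    (hg : Submodule.span ℝ (Set.range g) = ⊤) (p : V) :
    (∃ (S : Set ι) (b : Module.Basis S ℝ V), (∀ i, b i = g i) ∧ ∀ i, 0 ≤ b.repr p i) ∨
    ∃ θ : V →ₗ[ℝ] ℝ, (∀ i, θ (g i) ≤ 0) ∧ 0 < θ p := by
  obtain ⟨ω, h1, h2⟩ := exists_isGeneric_pos g
  rcases exists_isVertex_mem_cone_or_separated hg h1 h2 p with ⟨φ, -, b, hb, hp⟩ | h
  · exact Or.inl ⟨_, b, hb, hp⟩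
  · exact Or.inr h

end LinearInequalities

variable {d : ℕ}

theorem toReal_zero : toReal (0 : Fin d → ℤ) = 0 := by
  ext; simp [toReal]

theorem toReal_add (x y : Fin d → ℤ) : toReal (x + y) = toReal x + toReal y := by
  ext; simp [toReal]

theorem toReal_sub (x y : Fin d → ℤ) : toReal (x - y) = toReal x - toReal y := by
  ext; simp [toReal]

theorem toReal_zsmul (n : ℤ) (x : Fin d → ℤ) : toReal (n • x) = (n : ℝ) • toReal x := by
  ext; simp [toReal]

theorem toReal_nsmul (n : ℕ) (x : Fin d → ℤ) : toReal (n • x) = (n : ℝ) • toReal x := by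
  ext; simp [toReal]

theorem toReal_sum {ι : Type*} (s : Finset ι) (f : ι → Fin d → ℤ) :
    toReal (∑ i ∈ s, f i) = ∑ i ∈ s, toReal (f i) := by
  ext; simp [toReal, Finset.sum_apply]

theorem toReal_injective : Function.Injective (toReal : (Fin d → ℤ) → Fin d → ℝ) := by
  intro x y h
  ext i
  have := congrFun h i
  simpa [toReal] using this

/-! ### Exchange along bounded integer relations -/

/-- Exchanging along an integer relation `∑ γ i • β i = 0` between elements of a multiset. -/
theorem exists_multiset_exchange {M : Type*} [AddCommGroup M] {n : ℕ} (s : Multiset M)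
    (β : Fin n → M) (hβ : Function.Injective β) (γ : Fin n → ℤ)
    (hneg : ∀ i, γ i < 0 → ∀ [DecidableEq M], -γ i ≤ s.count (β i))
    (hrel : ∑ i, γ i • β i = 0) :
    ∃ s' : Multiset M, (∀ b ∈ s', b ∈ s ∨ ∃ i, b = β i) ∧ s'.sum = s.sum ∧
      (s'.card : ℤ) = s.card + ∑ i, γ i := by
  classical
  -- `u`, the negative part of the relation, is removed from `s` and replaced by the positive part
  -- `v`.
  set u : Multiset M := ∑ i, (-γ i).toNat • {β i} with hu
  set v : Multiset M := ∑ i, (γ i).toNat • {β i} with hv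
  have hus : u ≤ s := by
    rw [Multiset.le_iff_count]
    intro b
    rw [hu, Multiset.count_sum']
    by_cases hb : ∃ i, β i = b
    · obtain ⟨i, rfl⟩ := hb
      rw [Finset.sum_eq_single i]
      · rw [Multiset.count_nsmul, Multiset.count_singleton_self, mul_one]
        rcases lt_or_ge (γ i) 0 with h | h
        · have := hneg i h
          omega
        · omega
      · intro j _ hj
        rw [Multiset.count_nsmul, Multiset.count_singleton, if_neg (fun h => hj (hβ h.symm)),
          mul_zero]
      · simp
    · rw [Finset.sum_eq_zero]
      · exact Nat.zero_le _
      · intro i _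
        rw [Multiset.count_nsmul, Multiset.count_singleton, if_neg (fun h => hb ⟨i, h.symm⟩),
          mul_zero]
  have hdiff : ∀ i, γ i = ((γ i).toNat : ℤ) - ((-γ i).toNat : ℤ) := fun i => by omega
  have hsum : v.sum - u.sum = 0 := by
    rw [← hrel, hu, hv, Multiset.sum_sum, Multiset.sum_sum, ← Finset.sum_sub_distrib]
    refine Finset.sum_congr rfl fun i _ => ?_
    rw [Multiset.sum_nsmul, Multiset.sum_nsmul, Multiset.sum_singleton]
    conv_rhs => rw [hdiff i, sub_smul, natCast_zsmul, natCast_zsmul]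
  have hcard : (v.card : ℤ) - u.card = ∑ i, γ i := by
    rw [hu, hv, Multiset.card_sum, Multiset.card_sum, Nat.cast_sum, Nat.cast_sum, ← Finset.sum_sub_distrib]
    refine Finset.sum_congr rfl fun i _ => ?_
    rw [Multiset.card_nsmul, Multiset.card_nsmul, Multiset.card_singleton, mul_one, mul_one,
      ← hdiff i]
  obtain ⟨r, rfl⟩ := Multiset.le_iff_exists_add.1 hus
  refine ⟨r + v, ?_, ?_, ?_⟩
  · intro b hb
    rcases Multiset.mem_add.1 hb with h | h
    · exact Or.inl (Multiset.mem_add.2 (Or.inr h))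
    · right
      rw [hv, Multiset.mem_sum] at h
      obtain ⟨i, -, hi⟩ := h
      exact ⟨i, Multiset.mem_singleton.1 (Multiset.mem_of_mem_nsmul hi)⟩
  · rw [Multiset.sum_add, Multiset.sum_add, sub_eq_zero.1 hsum, add_comm]
  · rw [Multiset.card_add, Multiset.card_add]
    push_cast
    linarith

/-- The point `(1, x)` above `x`. -/
def lift (x : Fin d → ℤ) : Fin (d + 1) → ℤ := Fin.cons 1 x

theorem toReal_lift (x : Fin d → ℤ) : toReal (lift x) = Fin.cons 1 (toReal x) := by
  ext i
  refine Fin.cases ?_ (fun j => ?_) i <;> simp [toReal, lift]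

/-- Differences (1, e) - (1, 0) fill the hyperplane of first coordinate 0, and (1, 0) supplies the
rest. The extra coordinate records the cardinality of a multiset alongside its sum. -/
theorem span_lift_eq_top {E : Finset (Fin d → ℤ)}
    (hE : Submodule.span ℝ (toReal '' (E : Set (Fin d → ℤ))) = ⊤) :
    Submodule.span ℝ ((fun x => toReal (lift x)) '' (insert 0 (E : Set (Fin d → ℤ)))) = ⊤ := by
  set W := Submodule.span ℝ ((fun x => toReal (lift x)) '' (insert 0 (E : Set (Fin d → ℤ))))
  have hmem : ∀ x ∈ insert 0 (E : Set (Fin d → ℤ)), toReal (lift x) ∈ W := fun x hx =>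
    Submodule.subset_span ⟨x, hx, rfl⟩
  let L : (Fin d → ℝ) →ₗ[ℝ] (Fin (d + 1) → ℝ) :=
    { toFun := fun y => Fin.cons 0 y
      map_add' := fun x y => by ext i; refine Fin.cases ?_ (fun j => ?_) i <;> simp
      map_smul' := fun r y => by ext i; refine Fin.cases ?_ (fun j => ?_) i <;> simp }
  have hL : ∀ y, L y ∈ W := by
    intro y
    have hy : y ∈ Submodule.span ℝ (toReal '' (E : Set (Fin d → ℤ))) := hE ▸ trivial
    have hle : Submodule.span ℝ (toReal '' (E : Set (Fin d → ℤ))) ≤ W.comap L := by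
      rw [Submodule.span_le]
      rintro _ ⟨x, hx, rfl⟩
      have : L (toReal x) = toReal (lift x) - toReal (lift 0) := by
        rw [toReal_lift, toReal_lift, toReal_zero]
        ext i
        refine Fin.cases ?_ (fun j => ?_) i <;> simp [L]
      change L (toReal x) ∈ W
      rw [this]
      exact sub_mem (hmem _ (Or.inr hx)) (hmem _ (Or.inl rfl))
    exact hle hy
  rw [eq_top_iff]
  intro z _
  have : z = z 0 • toReal (lift 0) + L (Fin.tail z) := by
    rw [toReal_lift, toReal_zero]
    ext i
    refine Fin.cases ?_ (fun j => ?_) i <;> simp [L, Fin.tail]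
  rw [this]
  exact add_mem (Submodule.smul_mem _ _ (hmem _ (Or.inl rfl))) (hL _)

/-- The relation between the vectors `(1, β i)` expressing `(1, 0)`, with coefficients bounded by
minors. -/
theorem exists_bounded_relation {D : ℕ} (β : Fin (d + 1) → Fin d → ℤ)
    (hD : ∀ i : Fin (d + 1), (Matrix.of fun j => β (i.succAbove j)).det.natAbs ≤ D)
    (hβ : LinearIndependent ℝ fun i => toReal (lift (β i))) (c : Fin (d + 1) → ℝ)
    (hc : ∑ i, c i • toReal (lift (β i)) = - toReal (lift 0)) :
    ∃ γ : Fin (d + 1) → ℤ, (∀ i, |γ i| ≤ D) ∧ (∀ i, γ i < 0 → c i < 0) ∧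
      ∑ i, γ i • β i = 0 ∧ ∑ i, γ i < 0 := by
  let M : Matrix (Fin (d + 1)) (Fin (d + 1)) ℤ := Matrix.of fun i => lift (β i)
  have hδ : M.det ≠ 0 := by
    intro h0
    have h1 : (M.map (Int.cast : ℤ → ℝ)).det = 0 := by
      have := (Int.castRingHom ℝ).map_det M
      rw [h0] at this
      simpa using this.symm
    have h2 : LinearIndependent ℝ (M.map (Int.cast : ℤ → ℝ)).row := hβ
    rw [Matrix.linearIndependent_rows_iff_isUnit, Matrix.isUnit_iff_isUnit_det, h1] at h2
    exact not_isUnit_zero h2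
  -- Cramer's rule: the signed minors in this row combine the vectors (1, β i) to det · (1, 0).
  let y : Fin (d + 1) → ℤ := fun i => M.adjugate 0 i
  have hy : ∀ j, ∑ i, y i * lift (β i) j = if j = 0 then M.det else 0 := by
    intro j
    have := congrFun (congrFun (Matrix.adjugate_mul M) 0) j
    rw [Matrix.mul_apply] at this
    simp only [y]
    rw [show ∑ i, M.adjugate 0 i * lift (β i) j = ∑ i, M.adjugate 0 i * M i j from rfl, this]
    simp [Matrix.one_apply, eq_comm]
  have hyb : ∀ i, |y i| ≤ D := by
    intro i
    have h1 : y i = (-1) ^ ((i : ℕ) + ((0 : Fin (d + 1)) : ℕ)) *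
        (Matrix.of fun j => β (i.succAbove j)).det := by
      simp only [y]
      rw [Matrix.adjugate_fin_succ_eq_det_submatrix]
      congr 2
    rw [h1, abs_mul, abs_pow, abs_neg, abs_one, one_pow, one_mul, Int.abs_eq_natAbs]
    exact_mod_cast hD i
  have hyv : ∑ i, (y i : ℝ) • toReal (lift (β i)) = (M.det : ℝ) • toReal (lift 0) := by
    ext j
    have := hy j
    simp only [Finset.sum_apply, Pi.smul_apply, smul_eq_mul, toReal]
    have h2 : ((∑ i, y i * lift (β i) j : ℤ) : ℝ) = ∑ i, (y i : ℝ) * (lift (β i) j : ℝ) := by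
      push_cast; rfl
    rw [← h2, this]
    refine Fin.cases ?_ (fun k => ?_) j <;> simp [lift]
  have hcy : ∀ i, (y i : ℝ) = -(M.det : ℝ) * c i := by
    have h := Fintype.linearIndependent_iff.1 hβ (fun i => (y i : ℝ) + (M.det : ℝ) * c i) (by
      simp_rw [add_smul, mul_smul]
      rw [Finset.sum_add_distrib, ← Finset.smul_sum, hyv, hc]
      simp)
    intro i
    have := h i
    linarith
  have hyβ : ∑ i, y i • β i = 0 := by
    ext j
    have := hy j.succ
    simpa [lift, Finset.sum_apply] using this
  have hys : ∑ i, y i = M.det := by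
    have := hy 0
    simpa [lift] using this
  -- As y = -det · c, the sign is chosen to make γ = |det| · c. The coefficients of γ then add up to
  -- -|det|.
  rcases lt_or_gt_of_ne hδ with hneg | hpos
  · refine ⟨y, hyb, fun i hi => ?_, hyβ, by rw [hys]; exact hneg⟩
    have h1 : (y i : ℝ) < 0 := by exact_mod_cast hi
    have h2 : (M.det : ℝ) < 0 := by exact_mod_cast hneg
    rw [hcy i] at h1
    by_contra! h3
    nlinarith
  · refine ⟨fun i => - y i, fun i => by rw [abs_neg]; exact hyb i, fun i hi => ?_, ?_, ?_⟩
    · have h1 : -(y i : ℝ) < 0 := by exact_mod_cast hi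
      have h2 : (0 : ℝ) < M.det := by exact_mod_cast hpos
      rw [hcy i] at h1
      by_contra! h3
      nlinarith
    · simp_rw [neg_smul]
      rw [Finset.sum_neg_distrib, hyβ, neg_zero]
    · rw [Finset.sum_neg_distrib, hys]
      omega

/-- If `s` has the least cardinality among the multisets with the same sum, then the elements of
large multiplicity lie on a common facet avoiding the origin. -/
theorem exists_isVertex_of_card_min {E : Finset (Fin d → ℤ)}
    (hE : Submodule.span ℝ (toReal '' (E : Set (Fin d → ℤ))) = ⊤) {D : ℕ}
    (hD : ∀ p : Fin d → Fin d → ℤ, (∀ i, p i ∈ insert 0 E) → (Matrix.of p).det.natAbs ≤ D)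
    (s : Multiset (Fin d → ℤ))
    (hmin : ∀ s' : Multiset (Fin d → ℤ), (∀ b ∈ s', b ∈ s ∨ b ∈ insert 0 E) →
      s'.sum = s.sum → s.card ≤ s'.card) :
    ∃ φ : (Fin d → ℝ) →ₗ[ℝ] ℝ, IsVertex (fun e : E => toReal (e : Fin d → ℤ)) (fun _ => 1) φ ∧
      ∀ e ∈ E, D ≤ s.count e → φ (toReal e) = 1 := by
  classical
  let E₀ := insert 0 E
  let T := E.filter fun e => D ≤ s.count e
  -- The generators are (1, x) for x ∈ E ∪ {0} and -(1, e) for frequent e, so that only frequent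
  -- elements may receive a negative coefficient.
  let pt : E₀ ⊕ T → Fin d → ℤ := Sum.elim Subtype.val Subtype.val
  let sg : E₀ ⊕ T → ℝ := Sum.elim (fun _ => 1) (fun _ => -1)
  have hpt : ∀ i, pt i ∈ E₀ := by
    rintro (⟨i, hi⟩ | ⟨i, hi⟩)
    · exact hi
    · exact Finset.mem_insert_of_mem (Finset.mem_filter.1 hi).1
  have hsg0 : ∀ i, sg i ≠ 0 := by rintro (i | i) <;> simp [sg]
  let g : E₀ ⊕ T → Fin (d + 1) → ℝ := fun i => sg i • toReal (lift (pt i))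
  have hg : Submodule.span ℝ (Set.range g) = ⊤ := by
    rw [← top_le_iff, ← span_lift_eq_top hE]
    refine Submodule.span_mono ?_
    rintro _ ⟨x, hx, rfl⟩
    refine ⟨Sum.inl ⟨x, by simpa [E₀] using hx⟩, ?_⟩
    simp [g, sg, pt]
  rcases exists_basis_cone_or_separated hg (-toReal (lift 0)) with ⟨S, b, hb, hp⟩ | ⟨θ, hθ, hθp⟩
  -- If -(1, 0) is in the cone, the integer relation obtained removes at most `D` copies of each
  -- element, all of them available, and lowers the cardinality.
  · exfalso
    have := Fintype.ofFinite S
    have hcard : Fintype.card S = d + 1 := by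
      rw [← Module.finrank_eq_card_basis b]
      simp
    let e : Fin (d + 1) ≃ S := (Fintype.equivFinOfCardEq hcard).symm
    let β : Fin (d + 1) → Fin d → ℤ := fun i => pt (e i)
    have hli : LinearIndependent ℝ fun i => toReal (lift (β i)) := by
      have h1 := b.linearIndependent.comp e e.injective
      have h2 := h1.units_smul fun i => (Units.mk0 (sg (e i)) (hsg0 _))⁻¹
      have h3 : ((fun i => (Units.mk0 (sg (e i)) (hsg0 _))⁻¹) • (b ∘ e)) =
          fun i => toReal (lift (β i)) := by
        funext i
        simp only [Pi.smul_apply', Function.comp, hb, g, Units.smul_def, Units.val_inv_eq_inv_val,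
          Units.val_mk0, β]
        rw [inv_smul_smul₀ (hsg0 _)]
      rw [h3] at h2
      exact h2
    have hc : ∑ i, (b.repr (-toReal (lift 0)) (e i) * sg (e i)) • toReal (lift (β i)) =
        -toReal (lift 0) := by
      conv_rhs => rw [← b.sum_repr (-toReal (lift 0)), ← Equiv.sum_comp e]
      refine Finset.sum_congr rfl fun i _ => ?_
      rw [hb, mul_smul]
    obtain ⟨γ, hγD, hγc, hrel, hγs⟩ := exists_bounded_relation β
      (fun i => hD _ fun j => hpt _) hli _ hc
    have hβinj : Function.Injective β := fun i j hij => hli.injective (by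
      rw [hij])
    obtain ⟨s', h1, h2, h3⟩ := exists_multiset_exchange s β hβinj γ (by
      intro i hi inst
      have hneg := hγc i hi
      have hge := hp (e i)
      have hγi := hγD i
      rw [abs_of_neg hi] at hγi
      have key : D ≤ s.count (β i) := by
        rcases he : (e i : E₀ ⊕ T) with x | x
        · rw [he] at hneg
          simp only [sg, Sum.elim_inl, mul_one] at hneg
          linarith
        · simp only [β, he, pt, Sum.elim_inr]
          convert (Finset.mem_filter.1 x.2).2
      omega) hrel
    have := hmin s' (fun x hx => (h1 x hx).imp_right (by rintro ⟨i, rfl⟩; exact hpt _)) h2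
    omega
  -- Otherwise the separating functional is nonpositive on all (1, x), zero on the frequent ones and
  -- negative at (1, 0). Dividing by its value there yields a supporting hyperplane `φ = 1`.
  · set ρ := θ (toReal (lift 0)) with hρ
    have hρneg : ρ < 0 := by
      rw [map_neg] at hθp
      linarith
    let φ : (Fin d → ℝ) →ₗ[ℝ] ℝ :=
      { toFun := fun y => (θ (Fin.cons 0 y)) / (-ρ)
        map_add' := fun x y => by
          rw [← add_div, ← map_add]
          congr 2
          ext i; refine Fin.cases ?_ (fun j => ?_) i <;> simp
        map_smul' := fun r y => by
          rw [RingHom.id_apply, smul_eq_mul, ← mul_div_assoc, ← smul_eq_mul r, ← map_smul]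
          congr 2
          ext i; refine Fin.cases ?_ (fun j => ?_) i <;> simp }
    have hφ : ∀ x, φ (toReal x) = 1 + θ (toReal (lift x)) / (-ρ) := by
      intro x
      have : (Fin.cons 0 (toReal x) : Fin (d + 1) → ℝ) = toReal (lift x) - toReal (lift 0) := by
        rw [toReal_lift, toReal_lift, toReal_zero]
        ext i; refine Fin.cases ?_ (fun j => ?_) i <;> simp
      change θ _ / (-ρ) = _
      rw [this, map_sub, ← hρ]
      field_simp [hρneg.ne]
      ring
    have hle : ∀ x ∈ E₀, φ (toReal x) ≤ 1 := by
      intro x hx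
      have := hθ (Sum.inl ⟨x, hx⟩)
      simp only [g, sg, pt, Sum.elim_inl, one_smul] at this
      rw [hφ]
      have := div_nonpos_of_nonpos_of_nonneg this (by linarith : 0 ≤ -ρ)
      linarith
    have hT : ∀ x ∈ T, φ (toReal x) = 1 := by
      intro x hx
      refine le_antisymm (hle x (Finset.mem_insert_of_mem (Finset.mem_filter.1 hx).1)) ?_
      have := hθ (Sum.inr ⟨x, hx⟩)
      simp only [g, sg, pt, Sum.elim_inr, neg_smul, one_smul, map_neg] at this
      rw [hφ]
      have := div_nonneg (by linarith : 0 ≤ θ (toReal (lift x))) (by linarith : 0 ≤ -ρ)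
      linarith
    -- `φ` may support only a smaller face; passing to a vertex keeps the tight elements tight.
    obtain ⟨ψ, hψ, hsub⟩ := exists_isVertex (g := fun e : E => toReal (e : Fin d → ℤ))
      (ω := fun _ => 1) (by
        rw [← hE]
        congr 1
        ext z
        simp) φ (fun i => hle _ (Finset.mem_insert_of_mem i.2))
    refine ⟨ψ, hψ, fun x hx hxD => ?_⟩
    exact hsub (a := ⟨x, hx⟩) (hT x (Finset.mem_filter.2 ⟨hx, hxD⟩))

/-! ### Regular triangulation of the cone -/

/-- For small `t > 0`, a facet for the weights `1 + t η` also is one for the weights `1`. -/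
theorem eventually_isVertex_perturbation {V ι : Type*} [AddCommGroup V] [Module ℝ V] [Finite ι]
    (g : ι → V) (η : ι → ℝ) :
    ∀ᶠ t in nhdsWithin (0 : ℝ) (Set.Ioi 0), IsGeneric g (fun i => 1 + t * η i) →
      ∀ φ, IsVertex g (fun i => 1 + t * η i) φ → ∃ ψ : V →ₗ[ℝ] ℝ,
        (∀ i ∈ tight g (fun i => 1 + t * η i) φ, ψ (g i) = 1) ∧ ∀ i, ψ (g i) ≤ 1 := by
  have key : ∀ S : Set ι, ∀ᶠ t in nhdsWithin (0 : ℝ) (Set.Ioi 0),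
      IsGeneric g (fun i => 1 + t * η i) → ∀ φ, IsVertex g (fun i => 1 + t * η i) φ →
        tight g (fun i => 1 + t * η i) φ = S → ∃ ψ : V →ₗ[ℝ] ℝ,
        (∀ i ∈ S, ψ (g i) = 1) ∧ ∀ i, ψ (g i) ≤ 1 := by
    intro S
    by_cases hS : LinearIndependent ℝ (fun i : S => g i) ∧ Submodule.span ℝ (g '' S) = ⊤
    · obtain ⟨hli, hsp⟩ := hS
      let b := Module.Basis.mk hli (by rw [← hsp, Set.image_eq_range])
      have hb : ∀ i, b i = g i := fun i => by simp [b]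
      -- The equations on `S` force `φ = ψ + t • χ`, so an index with `ψ (g i) > 1` would violate
      -- its constraint for small `t`.
      let ψ : V →ₗ[ℝ] ℝ := b.constr ℝ fun _ => (1 : ℝ)
      let χ : V →ₗ[ℝ] ℝ := b.constr ℝ fun i => η i
      have hψ : ∀ i ∈ S, ψ (g i) = 1 := fun i hi => by
        rw [← hb ⟨i, hi⟩, b.constr_basis]
      have hχ : ∀ i ∈ S, χ (g i) = η i := fun i hi => by
        rw [← hb ⟨i, hi⟩, b.constr_basis]
      have hev : ∀ᶠ t in nhdsWithin (0 : ℝ) (Set.Ioi 0), ∀ i,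
          ψ (g i) + t * χ (g i) ≤ 1 + t * η i → ψ (g i) ≤ 1 := by
        rw [Filter.eventually_all]
        intro i
        by_cases hi : ψ (g i) ≤ 1
        · exact Filter.Eventually.of_forall fun _ _ => hi
        · have hc : ContinuousAt (fun t : ℝ => ψ (g i) + t * χ (g i) - (1 + t * η i)) 0 := by
            fun_prop
          have := (hc.eventually (lt_mem_nhds (a := 0) (by
            push Not at hi
            simp only [zero_mul, add_zero]
            linarith))).filter_mono (nhdsWithin_le_nhds (s := Set.Ioi 0))
          filter_upwards [this] with t ht h
          linarith
      filter_upwards [hev] with t ht _ φ hφ hφS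
      refine ⟨ψ, hψ, fun i => ht i ?_⟩
      have : φ = ψ + t • χ := by
        refine LinearMap.ext_on hφ.2 ?_
        rintro _ ⟨j, hj, rfl⟩
        have h1 : φ (g j) = 1 + t * η j := hj
        rw [hφS] at hj
        rw [h1, LinearMap.add_apply, LinearMap.smul_apply, hψ j hj, hχ j hj, smul_eq_mul]
      have h2 := hφ.1 i
      rwa [this] at h2
    · refine Filter.Eventually.of_forall fun t ht φ hφ hφS => absurd ?_ hS
      subst hφS
      exact ⟨ht φ, hφ.2⟩
  filter_upwards [Filter.eventually_all.2 key] with t ht hgen φ hφ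
  exact ht _ hgen φ hφ rfl

/-- Two simplicial cones of a generic lifting that share an interior point coincide. -/
theorem tight_subset_of_pos_combination {V ι κ : Type*} [AddCommGroup V] [Module ℝ V]
    [Fintype κ] {g : ι → V} {ω : ι → ℝ} {φ ψ : V →ₗ[ℝ] ℝ} (hφ : ∀ i, φ (g i) ≤ ω i) {σ : κ → ι}
    (hσ : ∀ j, ψ (g (σ j)) = ω (σ j)) {c : κ → ℝ} (hc : ∀ j, 0 < c j)
    (hle : ψ (∑ j, c j • g (σ j)) ≤ φ (∑ j, c j • g (σ j))) (j : κ) :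
    φ (g (σ j)) = ω (σ j) := by
  simp only [map_sum, map_smul, smul_eq_mul, hσ] at hle
  have h1 : ∑ j, c j * (ω (σ j) - φ (g (σ j))) = 0 := by
    refine le_antisymm ?_ (Finset.sum_nonneg fun j _ =>
      mul_nonneg (hc j).le (sub_nonneg.2 (hφ _)))
    simp only [mul_sub, Finset.sum_sub_distrib]
    linarith
  have h2 := (Finset.sum_eq_zero_iff_of_nonneg fun j _ =>
    mul_nonneg (hc j).le (sub_nonneg.2 (hφ _))).1 h1 j (Finset.mem_univ _)
  have h3 := (mul_eq_zero.1 h2).resolve_left (hc j).ne'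
  linarith

/-- The cone over a spanning set is triangulated by cones over simplices which lie on facets
avoiding the origin. -/
theorem exists_star_triangulation {E : Finset (Fin d → ℤ)}
    (hE : Submodule.span ℝ (toReal '' (E : Set (Fin d → ℤ))) = ⊤) :
    ∃ 𝒯 : Finset (Fin d → Fin d → ℤ),
      (∀ σ ∈ 𝒯, (∀ i, σ i ∈ E) ∧ LinearIndependent ℝ (fun i => toReal (σ i)) ∧
        ∃ φ : (Fin d → ℝ) →ₗ[ℝ] ℝ, (∀ i, φ (toReal (σ i)) = 1) ∧ ∀ e ∈ E, φ (toReal e) ≤ 1) ∧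
      (∀ p ∈ cone E, ∃ σ ∈ 𝒯, ∃ c : Fin d → ℝ, (∀ i, 0 ≤ c i) ∧
        p = ∑ i, c i • toReal (σ i)) ∧
      ∀ σ ∈ 𝒯, ∀ τ ∈ 𝒯, ∀ c c' : Fin d → ℝ, (∀ i, 0 < c i) → (∀ i, 0 < c' i) →
        ∑ i, c i • toReal (σ i) = ∑ i, c' i • toReal (τ i) → σ = τ := by
  classical
  let g : E → Fin d → ℝ := fun e => toReal (e : Fin d → ℤ)
  have hg : Submodule.span ℝ (Set.range g) = ⊤ := by
    rw [← hE]
    congr 1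
    ext z
    simp [g]
  obtain ⟨η, hη⟩ := exists_eventually_isGeneric g
  -- Generic weights make the cells simplicial; weights close to 1 keep each cell on a supporting
  -- hyperplane of `E`.
  obtain ⟨t, ⟨hgen, hω⟩, hpert⟩ :=
    ((hη.and (eventually_forall_one_add_mul_pos η)).and (eventually_isVertex_perturbation g η)).exists
  specialize hpert hgen
  set ω : E → ℝ := fun i => 1 + t * η i with hωdef
  let P := {S : Set E // ∃ φ, IsVertex g ω φ ∧ tight g ω φ = S}
  have hcard : ∀ S : P, Nonempty (Fin d ≃ S.1) := by
    rintro ⟨_, φ, hφ, rfl⟩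
    let b := Module.Basis.mk (hgen φ) (by rw [← hφ.2, Set.image_eq_range])
    have := Fintype.ofFinite (tight g ω φ)
    refine ⟨(Fintype.equivFinOfCardEq ?_).symm⟩
    rw [← Module.finrank_eq_card_basis b]
    simp
  let e : ∀ S : P, Fin d ≃ S.1 := fun S => (hcard S).some
  have := Fintype.ofFinite P
  refine ⟨Finset.univ.image fun (S : P) i => ((e S i : E) : Fin d → ℤ), ?_, ?_, ?_⟩
  · intro σ hσ
    obtain ⟨⟨S, φ, hφ, rfl⟩, -, rfl⟩ := Finset.mem_image.1 hσ
    refine ⟨fun i => Subtype.coe_prop _, (hgen φ).comp _ (Equiv.injective _), ?_⟩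
    obtain ⟨ψ, h1, h2⟩ := hpert φ hφ
    exact ⟨ψ, fun i => h1 _ (Subtype.coe_prop _), fun x hx => h2 ⟨x, hx⟩⟩
  · rintro p ⟨c, hc, rfl⟩
    rcases exists_isVertex_mem_cone_or_separated hg hgen (fun i => (hω i).le)
      (∑ a ∈ E, c a • toReal a) with ⟨φ, hφ, b, hb, hp⟩ | ⟨θ, hθ, hθp⟩
    · have hS : ∃ φ', IsVertex g ω φ' ∧ tight g ω φ' = tight g ω φ := ⟨φ, hφ, rfl⟩
      refine ⟨_, Finset.mem_image_of_mem _ (Finset.mem_univ ⟨_, hS⟩),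
        fun i => b.repr (∑ a ∈ E, c a • toReal a) (e ⟨_, hS⟩ i), fun i => hp _, ?_⟩
      have := Fintype.ofFinite (tight g ω φ)
      conv_lhs => rw [← b.sum_repr (∑ a ∈ E, c a • toReal a), ← Equiv.sum_comp (e ⟨_, hS⟩)]
      refine Finset.sum_congr rfl fun i _ => ?_
      rw [hb]
    · exfalso
      rw [map_sum] at hθp
      refine absurd hθp (not_lt.2 (Finset.sum_nonpos fun a ha => ?_))
      rw [map_smul, smul_eq_mul]
      exact mul_nonpos_of_nonneg_of_nonpos (hc a ha) (hθ ⟨a, ha⟩)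
  · intro σ hσ τ hτ c c' hc hc' hsum
    obtain ⟨⟨S, hS⟩, -, rfl⟩ := Finset.mem_image.1 hσ
    obtain ⟨⟨S', hS'⟩, -, rfl⟩ := Finset.mem_image.1 hτ
    suffices S = S' by
      subst this
      rfl
    obtain ⟨φ, hφ, hφS⟩ := id hS
    obtain ⟨φ', hφ', hφS'⟩ := id hS'
    have hsum' : ∑ i, c i • g (e ⟨S, hS⟩ i) = ∑ i, c' i • g (e ⟨S', hS'⟩ i) := hsum
    have ht : ∀ i, φ (g (e ⟨S, hS⟩ i)) = ω (e ⟨S, hS⟩ i) := fun i => by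
      have h := (e ⟨S, hS⟩ i).2
      simp only [← hφS] at h
      exact h
    have ht' : ∀ i, φ' (g (e ⟨S', hS'⟩ i)) = ω (e ⟨S', hS'⟩ i) := fun i => by
      have h := (e ⟨S', hS'⟩ i).2
      simp only [← hφS'] at h
      exact h
    -- On the cone of its own cell a vertex dominates every feasible functional. At a common
    -- interior point the two vertices therefore agree, and each is tight on the other's cell.
    have hval : ∀ (χ χ' : (Fin d → ℝ) →ₗ[ℝ] ℝ) (Q : P) (a : Fin d → ℝ), (∀ i, 0 < a i) →
        (∀ i, χ (g i) ≤ ω i) → (∀ i, χ' (g (e Q i)) = ω (e Q i)) →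
        χ (∑ i, a i • g (e Q i)) ≤ χ' (∑ i, a i • g (e Q i)) := by
      intro χ χ' Q a ha h1 h2
      simp only [map_sum, map_smul, smul_eq_mul, h2]
      exact Finset.sum_le_sum fun i _ => mul_le_mul_of_nonneg_left (h1 _) (ha i).le
    have hle1 := hval φ' φ ⟨S, hS⟩ c hc hφ'.1 ht
    have hle2 := hval φ φ' ⟨S', hS'⟩ c' hc' hφ.1 ht'
    have h1 : S ⊆ S' := by
      intro x hx
      rw [← hφS']
      obtain ⟨i, hi⟩ := (e ⟨S, hS⟩).surjective ⟨x, hx⟩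
      have := tight_subset_of_pos_combination hφ'.1 ht hc (by rw [hsum']; exact hle2) i
      rw [hi] at this
      exact this
    have h2 : S' ⊆ S := by
      intro x hx
      rw [← hφS]
      obtain ⟨i, hi⟩ := (e ⟨S', hS'⟩).surjective ⟨x, hx⟩
      have := tight_subset_of_pos_combination hφ.1 ht' hc' (by rw [← hsum']; exact hle1) i
      rw [hi] at this
      exact this
    exact h1.antisymm h2

/-! ### Determinants of the cells and volume -/

open MeasureTheory

/-- The open corner simplex. -/
def openSimplex (d : ℕ) : Set (Fin d → ℝ) := {c | (∀ i, 0 < c i) ∧ ∑ i, c i < 1}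

theorem measurableSet_openSimplex : MeasurableSet (openSimplex d) := by
  have : openSimplex d = (⋂ i, {c | 0 < c i}) ∩ {c | ∑ i, c i < 1} := by
    ext c
    simp [openSimplex]
  rw [this]
  refine MeasurableSet.inter (MeasurableSet.iInter fun i => ?_) ?_
  · exact measurableSet_lt measurable_const (measurable_pi_apply i)
  · exact measurableSet_lt (by fun_prop) measurable_const

/-- The ℓ¹ ball has volume 2^d / d! and, up to coordinate hyperplanes, is covered by the 2^d
reflections of the simplex. Only this lower bound is needed. -/
theorem inv_factorial_le_volume_openSimplex :
    ENNReal.ofReal (1 / (d.factorial : ℝ)) ≤ volume (openSimplex d) := by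
  let L : (Fin d → ℤˣ) → ((Fin d → ℝ) →ₗ[ℝ] (Fin d → ℝ)) := fun ε =>
    Matrix.toLin' (Matrix.diagonal fun i => (((ε i : ℤˣ) : ℤ) : ℝ))
  have hL : ∀ ε, volume (L ε '' openSimplex d) = volume (openSimplex d) := by
    intro ε
    rw [Measure.addHaar_image_linearMap, LinearMap.det_toLin', Matrix.det_diagonal,
      Finset.abs_prod]
    have : ∏ i, |(((ε i : ℤˣ) : ℤ) : ℝ)| = 1 := Finset.prod_eq_one fun i _ => by
      rcases Int.units_eq_one_or (ε i) with h | h <;> simp [h]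
    rw [this]
    simp
  have hvol : volume {x : Fin d → ℝ | ∑ i, |x i| ^ (1 : ℝ) < 1} =
      ENNReal.ofReal (2 ^ d / (d.factorial : ℝ)) := by
    rw [volume_sum_rpow_lt_one (Fin d) le_rfl]
    congr 2
    · simp only [div_one, Fintype.card_fin]
      norm_num
    · rw [div_one, Fintype.card_fin, Real.Gamma_nat_eq_factorial]
  have hsub : {x : Fin d → ℝ | ∑ i, |x i| ^ (1 : ℝ) < 1} ⊆
      (⋃ ε ∈ (Finset.univ : Finset (Fin d → ℤˣ)), L ε '' openSimplex d) ∪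
        ⋃ i ∈ (Finset.univ : Finset (Fin d)), {x | x i = 0} := by
    intro x hx
    by_cases h0 : ∃ i, x i = 0
    · right
      simpa using h0
    · left
      push Not at h0
      simp only [Real.rpow_one, Set.mem_ofPred_eq] at hx
      simp only [Finset.mem_univ, Set.iUnion_true, Set.mem_iUnion]
      refine ⟨fun i => if 0 < x i then 1 else -1, fun i => |x i|,
        ⟨fun i => abs_pos.2 (h0 i), hx⟩, ?_⟩
      ext i
      simp only [L, Matrix.toLin'_apply, Matrix.mulVec_diagonal]
      split_ifs with h
      · simp [abs_of_pos h]
      · simp [abs_of_nonpos (not_lt.1 h)]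
  have h1 := (measure_mono hsub).trans (measure_union_le (μ := volume) _ _)
  have h2 : volume (⋃ i ∈ (Finset.univ : Finset (Fin d)), {x : Fin d → ℝ | x i = 0}) = 0 := by
    simp only [Finset.mem_univ, Set.iUnion_true, measure_iUnion_null_iff]
    intro i
    rw [volume_pi]
    exact Measure.pi_hyperplane _ i 0
  have h3 := measure_biUnion_finset_le (μ := volume) (Finset.univ : Finset (Fin d → ℤˣ))
    fun ε => L ε '' openSimplex d
  simp only [hL, Finset.sum_const, Finset.card_univ, Fintype.card_fun, Fintype.card_fin,
    Fintype.card_units_int] at h3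
  rw [hvol, h2, add_zero] at h1
  have h4 := h1.trans h3
  have h5 : ENNReal.ofReal (2 ^ d / (d.factorial : ℝ)) =
      (2 ^ d : ℕ) • ENNReal.ofReal (1 / (d.factorial : ℝ)) := by
    rw [nsmul_eq_mul, ← ENNReal.ofReal_natCast, ← ENNReal.ofReal_mul (by positivity)]
    congr 1
    push_cast
    ring
  rw [h5, nsmul_eq_mul, nsmul_eq_mul] at h4
  exact (ENNReal.mul_le_mul_iff_right (by simp) (ENNReal.natCast_ne_top _)).1 h4

/-- The linear map sending the standard basis to `σ`. -/
def cellMap (σ : Fin d → Fin d → ℤ) : (Fin d → ℝ) →ₗ[ℝ] (Fin d → ℝ) :=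
  Matrix.toLin' ((Matrix.of σ).map (Int.cast : ℤ → ℝ)).transpose

theorem cellMap_apply (σ : Fin d → Fin d → ℤ) (c : Fin d → ℝ) :
    cellMap σ c = ∑ i, c i • toReal (σ i) := by
  ext j
  simp [cellMap, Matrix.mulVec, dotProduct, toReal, Finset.sum_apply, mul_comm]

theorem det_cellMap (σ : Fin d → Fin d → ℤ) :
    LinearMap.det (cellMap σ) = ((Matrix.of σ).det : ℝ) := by
  rw [cellMap, LinearMap.det_toLin', Matrix.det_transpose]
  exact ((Int.castRingHom ℝ).map_det (Matrix.of σ)).symm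

theorem det_ne_zero_of_linearIndependent {σ : Fin d → Fin d → ℤ}
    (hσ : LinearIndependent ℝ fun i => toReal (σ i)) : (Matrix.of σ).det ≠ 0 := by
  intro h0
  have h1 : ((Matrix.of σ).map (Int.cast : ℤ → ℝ)).det = 0 := by
    have := (Int.castRingHom ℝ).map_det (Matrix.of σ)
    rw [h0] at this
    simpa using this.symm
  have h2 : LinearIndependent ℝ ((Matrix.of σ).map (Int.cast : ℤ → ℝ)).row := hσ
  rw [Matrix.linearIndependent_rows_iff_isUnit, Matrix.isUnit_iff_isUnit_det, h1] at h2
  exact not_isUnit_zero h2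

theorem isCompact_hull (A : Finset (Fin d → ℤ)) : IsCompact (hull A) :=
  Set.Finite.isCompact_convexHull ℝ (A.finite_toSet.image toReal)

/-- The open simplices spanned by 0 and the cells are disjoint, lie in the hull, and have volume at
least |det σ| / d!. -/
theorem sum_natAbs_det_le_factorial_mul_vol {E B : Finset (Fin d → ℤ)} (hEB : E ⊆ B) (h0 : 0 ∈ B)
    (𝒯 : Finset (Fin d → Fin d → ℤ))
    (hmem : ∀ σ ∈ 𝒯, (∀ i, σ i ∈ E) ∧ LinearIndependent ℝ (fun i => toReal (σ i)))
    (hdisj : ∀ σ ∈ 𝒯, ∀ τ ∈ 𝒯, ∀ c c' : Fin d → ℝ, (∀ i, 0 < c i) → (∀ i, 0 < c' i) →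
        ∑ i, c i • toReal (σ i) = ∑ i, c' i • toReal (τ i) → σ = τ) :
    ((∑ σ ∈ 𝒯, (Matrix.of σ).det.natAbs : ℕ) : ℝ) ≤ d.factorial * vol B := by
  have hinj : ∀ σ ∈ 𝒯, Function.Injective (cellMap σ) := fun σ hσ => by
    rw [← LinearMap.ker_eq_bot]
    refine LinearMap.ker_eq_bot'.2 fun c hc => ?_
    rw [cellMap_apply] at hc
    exact funext (Fintype.linearIndependent_iff.1 (hmem σ hσ).2 c hc)
  have hsub : (⋃ σ ∈ 𝒯, cellMap σ '' openSimplex d) ⊆ hull B := by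
    refine Set.iUnion₂_subset fun σ hσ => ?_
    rintro _ ⟨c, ⟨hc, hc1⟩, rfl⟩
    rw [cellMap_apply]
    have hm : ∀ b ∈ B, toReal b ∈ hull B := fun b hb => subset_convexHull ℝ _ ⟨b, hb, rfl⟩
    have := (convex_convexHull ℝ (toReal '' (B : Set (Fin d → ℤ)))).sum_mem
      (t := (Finset.univ : Finset (Option (Fin d))))
      (w := fun o => o.elim (1 - ∑ i, c i) c) (z := fun o => o.elim (toReal 0) fun i => toReal (σ i))
      (by
        rintro (_ | i) _
        · exact sub_nonneg.2 hc1.le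
        · exact (hc i).le)
      (by simp [Fintype.sum_option])
      (by
        rintro (_ | i) _
        · exact hm 0 h0
        · exact hm _ (hEB ((hmem σ hσ).1 i)))
    simpa [hull, Fintype.sum_option, toReal_zero] using this
  have hvolc : ∀ σ ∈ 𝒯, ENNReal.ofReal ((Matrix.of σ).det.natAbs * (1 / (d.factorial : ℝ))) ≤
      volume (cellMap σ '' openSimplex d) := by
    intro σ _
    rw [Measure.addHaar_image_linearMap, det_cellMap, ENNReal.ofReal_mul (by positivity),
      Nat.cast_natAbs, Int.cast_abs]
    gcongr
    exact inv_factorial_le_volume_openSimplex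
  have hdis : (𝒯 : Set (Fin d → Fin d → ℤ)).PairwiseDisjoint
      fun σ => cellMap σ '' openSimplex d := by
    intro σ hσ τ hτ hne
    refine Set.disjoint_left.2 ?_
    rintro _ ⟨c, hc, rfl⟩ ⟨c', hc', h⟩
    rw [cellMap_apply, cellMap_apply] at h
    exact hne (hdisj σ hσ τ hτ c c' hc.1 hc'.1 h.symm)
  have hmeas : ∀ σ ∈ 𝒯, MeasurableSet (cellMap σ '' openSimplex d) := fun σ hσ =>
    measurableSet_openSimplex.image_of_continuousOn_injOn
      (LinearMap.continuous_of_finiteDimensional _).continuousOn (hinj σ hσ).injOn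
  have h1 : ENNReal.ofReal (∑ σ ∈ 𝒯, (Matrix.of σ).det.natAbs * (1 / (d.factorial : ℝ))) ≤
      volume (hull B) := by
    rw [ENNReal.ofReal_sum_of_nonneg fun σ _ => by positivity]
    refine (Finset.sum_le_sum hvolc).trans ?_
    rw [← measure_biUnion_finset hdis hmeas]
    exact measure_mono hsub
  have h2 : ∑ σ ∈ 𝒯, (Matrix.of σ).det.natAbs * (1 / (d.factorial : ℝ)) ≤ vol B :=
    (ENNReal.ofReal_le_iff_le_toReal (isCompact_hull B).measure_lt_top.ne).1 h1
  rw [← Finset.sum_mul, mul_one_div, div_le_iff₀ (by positivity)] at h2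
  push_cast
  linarith

/-! ### Zero-sum selections and shortest representations -/

/-- Pigeonhole on partial sums: at least |G| terms have at least |G| + 1 partial sums, and the block
between two equal ones is the selection. -/
theorem exists_submultiset_map_sum_eq_zero {M G : Type*} [AddCommGroup M] [AddCommGroup G]
    [Finite G] (f : M →+ G) (t : Multiset M) (ht : Nat.card G ≤ t.card) :
    ∃ u ≤ t, u ≠ 0 ∧ f u.sum = 0 := by
  have := Fintype.ofFinite G
  induction t using Quotient.inductionOn with
  | _ l =>
  have hl : Nat.card G ≤ l.length := ht
  obtain ⟨i, j, hij, h⟩ : ∃ i j : Fin (l.length + 1), i < j ∧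
      f (l.take i).sum = f (l.take j).sum := by
    obtain ⟨i, j, hne, h⟩ := Fintype.exists_ne_map_eq_of_card_lt
      (fun i : Fin (l.length + 1) => f (l.take i).sum) (by
        rw [Fintype.card_fin, ← Nat.card_eq_fintype_card]
        omega)
    rcases lt_or_gt_of_ne hne with h' | h'
    · exact ⟨i, j, h', h⟩
    · exact ⟨j, i, h', h.symm⟩
  have hij' : (i : ℕ) < j := hij
  refine ⟨((l.take j).drop i : List M), ?_, ?_, ?_⟩
  · exact Multiset.coe_le.2 ((List.drop_sublist _ _).trans (List.take_sublist _ _)).subperm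
  · intro h0
    have h1 := congrArg Multiset.card h0
    rw [Multiset.coe_card, List.length_drop, List.length_take, Multiset.card_zero] at h1
    omega
  · have h1 : (l.take j).sum = (l.take i).sum + ((l.take j).drop i).sum := by
      rw [← List.sum_append]
      congr 1
      conv_lhs => rw [← List.take_append_drop i (l.take j)]
      rw [List.take_take, min_eq_left hij'.le]
    rw [h1, map_add, left_eq_add] at h
    rw [Multiset.sum_coe, h]

/-- Among `|det σ|` lattice points some nonempty selection has its sum in the lattice of `σ`. -/
theorem exists_submultiset_sum_mem_lattice {σ : Fin d → Fin d → ℤ}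
    (hσ : LinearIndependent ℝ fun i => toReal (σ i)) (t : Multiset (Fin d → ℤ))
    (ht : (Matrix.of σ).det.natAbs ≤ t.card) :
    ∃ u ≤ t, u ≠ 0 ∧ ∃ c : Fin d → ℤ, u.sum = ∑ i, c i • σ i := by
  have hli : LinearIndependent ℤ σ := by
    rw [Fintype.linearIndependent_iff]
    intro c hc i
    have := Fintype.linearIndependent_iff.1 hσ (fun i => (c i : ℝ)) (by
      simp_rw [← toReal_zsmul]
      rw [← toReal_sum, hc, toReal_zero]) i
    exact_mod_cast this
  let L := Submodule.span ℤ (Set.range σ)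
  have hcard : (Matrix.of σ).det.natAbs = Nat.card ((Fin d → ℤ) ⧸ L) := by
    rw [← Submodule.natAbs_det_basis_change (Pi.basisFun ℤ (Fin d)) L (Module.Basis.span hli),
      Pi.basisFun_det]
    congr 2
    ext i j
    exact congrFun (congrArg Subtype.val (Module.Basis.span_apply hli i).symm) j
  have : Finite ((Fin d → ℤ) ⧸ L) := Nat.finite_of_card_ne_zero (by
    rw [← hcard]
    exact Int.natAbs_ne_zero.2 (det_ne_zero_of_linearIndependent hσ))
  obtain ⟨u, h1, h2, h3⟩ := exists_submultiset_map_sum_eq_zero L.mkQ.toAddMonoidHom t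
    (hcard ▸ ht)
  refine ⟨u, h1, h2, ?_⟩
  have h4 : u.sum ∈ L := (Submodule.Quotient.mk_eq_zero L).1 h3
  obtain ⟨c, hc⟩ := (Submodule.mem_span_range_iff_exists_fun ℤ).1 h4
  exact ⟨c, hc.symm⟩

/-- A sum of lattice points of the cone over `σ` which lies in the lattice of `σ` is a sum of
at most as many elements of `σ`. -/
theorem exists_multiset_of_sum_mem_lattice {σ : Fin d → Fin d → ℤ}
    (hσ : LinearIndependent ℝ fun i => toReal (σ i)) {φ : (Fin d → ℝ) →ₗ[ℝ] ℝ}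
    (hφσ : ∀ i, φ (toReal (σ i)) = 1) (u : Multiset (Fin d → ℤ))
    (hu : ∀ b ∈ u, φ (toReal b) ≤ 1 ∧
      ∃ c : Fin d → ℝ, (∀ i, 0 ≤ c i) ∧ toReal b = ∑ i, c i • toReal (σ i))
    {c : Fin d → ℤ} (hc : u.sum = ∑ i, c i • σ i) :
    ∃ v : Multiset (Fin d → ℤ), (∀ b ∈ v, ∃ i, b = σ i) ∧ v.sum = u.sum ∧ v.card ≤ u.card := by
  have key : φ (toReal u.sum) ≤ u.card ∧
      ∃ c : Fin d → ℝ, (∀ i, 0 ≤ c i) ∧ toReal u.sum = ∑ i, c i • toReal (σ i) := by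
    clear hc
    induction u using Multiset.induction_on with
    | empty => exact ⟨by simp [toReal_zero], 0, fun _ => le_rfl, by simp [toReal_zero]⟩
    | cons a u ih =>
      obtain ⟨h1, c', hc', h2⟩ := ih fun b hb => hu b (Multiset.mem_cons_of_mem hb)
      obtain ⟨h3, c'', hc'', h4⟩ := hu a (Multiset.mem_cons_self a u)
      rw [Multiset.sum_cons, toReal_add]
      refine ⟨?_, c'' + c', fun i => add_nonneg (hc'' i) (hc' i), ?_⟩
      · rw [map_add, Multiset.card_cons]
        push_cast
        linarith
      · rw [h2, h4, ← Finset.sum_add_distrib]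
        exact Finset.sum_congr rfl fun i _ => (add_smul _ _ _).symm
  obtain ⟨hle, c', hc', h2⟩ := key
  have hsum : toReal u.sum = ∑ i, (c i : ℝ) • toReal (σ i) := by
    rw [hc, toReal_sum]
    exact Finset.sum_congr rfl fun i _ => toReal_zsmul _ _
  -- Coordinates in σ are unique, so the integer coefficients are nonnegative. Their total is the
  -- value of `φ` at the sum, which is at most the number of terms of `u`.
  have hcc : ∀ i, (c i : ℝ) = c' i := fun i => by
    have := Fintype.linearIndependent_iff.1 hσ (fun i => (c i : ℝ) - c' i) (by
      simp_rw [sub_smul]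
      rw [Finset.sum_sub_distrib, ← hsum, ← h2, sub_self]) i
    linarith
  have hc0 : ∀ i, 0 ≤ c i := fun i => by
    have := hc' i
    rw [← hcc i] at this
    exact_mod_cast this
  refine ⟨∑ i, (c i).toNat • {σ i}, fun b hb => ?_, ?_, ?_⟩
  · obtain ⟨i, -, hi⟩ := Multiset.mem_sum.1 hb
    exact ⟨i, Multiset.mem_singleton.1 (Multiset.mem_of_mem_nsmul hi)⟩
  · rw [Multiset.sum_sum, hc]
    refine Finset.sum_congr rfl fun i _ => ?_
    rw [Multiset.sum_nsmul, Multiset.sum_singleton, ← natCast_zsmul, Int.toNat_of_nonneg (hc0 i)]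
  · rw [Multiset.card_sum]
    have h3 : φ (toReal u.sum) = ∑ i, (c i : ℝ) := by
      rw [hsum, map_sum]
      exact Finset.sum_congr rfl fun i _ => by rw [map_smul, hφσ, smul_eq_mul, mul_one]
    rw [h3] at hle
    have h4 : (((∑ i, (Multiset.card ((c i).toNat • ({σ i} : Multiset (Fin d → ℤ))))) : ℕ) : ℝ) =
        ∑ i, (c i : ℝ) := by
      push_cast
      refine Finset.sum_congr rfl fun i _ => ?_
      rw [Multiset.card_nsmul, Multiset.card_singleton, mul_one]
      have := Int.toNat_of_nonneg (hc0 i)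
      exact_mod_cast this
    rw [← h4] at hle
    exact_mod_cast hle

theorem exists_forall_le_nat {α : Type*} {p : α → Prop} (f : α → ℕ) (h : ∃ a, p a) :
    ∃ a, p a ∧ ∀ b, p b → f a ≤ f b := by
  obtain ⟨a, ha, hmin⟩ := (InvImage.wf f Nat.lt_wfRel.wf).has_min {a | p a} h
  exact ⟨a, ha, fun b hb => not_lt.1 (hmin b hb)⟩

/-- `s` has the least cardinality among the multisets over `B` with the same sum. -/
def IsShortest (B : Finset (Fin d → ℤ)) (s : Multiset (Fin d → ℤ)) : Prop :=
  (∀ b ∈ s, b ∈ B) ∧ ∀ s' : Multiset (Fin d → ℤ), (∀ b ∈ s', b ∈ B) → s'.sum = s.sum →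
    s.card ≤ s'.card

theorem exists_isShortest {B : Finset (Fin d → ℤ)} (s : Multiset (Fin d → ℤ))
    (hs : ∀ b ∈ s, b ∈ B) : ∃ s', IsShortest B s' ∧ s'.sum = s.sum := by
  obtain ⟨s', ⟨h1, h2⟩, h3⟩ := exists_forall_le_nat
    (p := fun s' : Multiset (Fin d → ℤ) => (∀ b ∈ s', b ∈ B) ∧ s'.sum = s.sum)
    Multiset.card ⟨s, hs, rfl⟩
  exact ⟨s', ⟨h1, fun u hu hsum => h3 u ⟨hu, hsum.trans h2⟩⟩, h2⟩

theorem IsShortest.zero_notMem {B : Finset (Fin d → ℤ)} {s : Multiset (Fin d → ℤ)}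
    (hs : IsShortest B s) : (0 : Fin d → ℤ) ∉ s := by
  intro h
  obtain ⟨t, rfl⟩ := Multiset.exists_cons_of_mem h
  have := hs.2 t (fun b hb => hs.1 b (Multiset.mem_cons_of_mem hb)) (by simp)
  rw [Multiset.card_cons] at this
  omega

theorem mem_cone_of_mem_hull_insert {E : Finset (Fin d → ℤ)} {p : Fin d → ℝ}
    (hp : p ∈ hull (insert 0 E)) : p ∈ cone E := by
  have hp' : p ∈ convexHull ℝ (((insert 0 E).image toReal : Finset (Fin d → ℝ)) :
      Set (Fin d → ℝ)) := by
    rw [Finset.coe_image]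
    exact hp
  rw [Finset.mem_convexHull'] at hp'
  obtain ⟨w, hw, -, rfl⟩ := hp'
  refine ⟨fun a => w (toReal a), fun a ha =>
    hw _ (Finset.mem_image_of_mem _ (Finset.mem_insert_of_mem ha)), ?_⟩
  rw [Finset.sum_image toReal_injective.injOn]
  refine (Finset.sum_subset (Finset.subset_insert _ _) fun x hx hx' => ?_).symm
  rw [(Finset.mem_insert.1 hx).resolve_right hx', toReal_zero, smul_zero]

theorem le_one_of_mem_hull_insert {E : Finset (Fin d → ℤ)} {φ : (Fin d → ℝ) →ₗ[ℝ] ℝ}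
    (hφ : ∀ e ∈ E, φ (toReal e) ≤ 1) {p : Fin d → ℝ} (hp : p ∈ hull (insert 0 E)) : φ p ≤ 1 := by
  have : hull (insert 0 E) ⊆ {x | φ x ≤ 1} := by
    refine convexHull_min ?_ (convex_halfSpace_le φ.isLinear 1)
    rintro _ ⟨x, hx, rfl⟩
    rcases Finset.mem_insert.1 (Finset.mem_coe.1 hx) with rfl | h
    · simp [toReal_zero]
    · exact hφ x h
  exact this hp

/-- A shortest representation can be chosen with few elements outside a set `E` that together with
the origin spans the convex hull. -/
theorem exists_isShortest_filter_card_lt {E B : Finset (Fin d → ℤ)} (hEB : E ⊆ B)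
    (h0 : 0 ∈ B) (hE : Submodule.span ℝ (toReal '' (E : Set (Fin d → ℤ))) = ⊤)
    (hB : ∀ b ∈ B, toReal b ∈ hull (insert 0 E)) (s : Multiset (Fin d → ℤ))
    (hs : ∀ b ∈ s, b ∈ B) :
    ∃ s', IsShortest B s' ∧ s'.sum = s.sum ∧
      ((s'.filter fun b => b ∉ E).card : ℝ) + 1 ≤ d.factorial * vol B := by
  obtain ⟨𝒯, h𝒯, hcov, hdisj⟩ := exists_star_triangulation hE
  have hvol := sum_natAbs_det_le_factorial_mul_vol hEB h0 𝒯
    (fun σ hσ => ⟨(h𝒯 σ hσ).1, (h𝒯 σ hσ).2.1⟩) hdisj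
  -- A second minimisation: among the shortest representations, one with the fewest terms outside
  -- `E`.
  obtain ⟨s', ⟨h1, h2⟩, h3⟩ := exists_forall_le_nat
    (p := fun s' : Multiset (Fin d → ℤ) => IsShortest B s' ∧ s'.sum = s.sum)
    (fun s' => (s'.filter fun b => b ∉ E).card) (exists_isShortest s hs)
  refine ⟨s', h1, h2, le_trans ?_ hvol⟩
  have hcell : ∀ b, ∃ σ, b ∈ B → σ ∈ 𝒯 ∧ ∃ c : Fin d → ℝ, (∀ i, 0 ≤ c i) ∧
      toReal b = ∑ i, c i • toReal (σ i) := fun b => by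
    by_cases hb : b ∈ B
    · obtain ⟨σ, hσ, hc⟩ := hcov _ (mem_cone_of_mem_hull_insert (hB b hb))
      exact ⟨σ, fun _ => ⟨hσ, hc⟩⟩
    · exact ⟨fun _ => 0, fun h => absurd h hb⟩
  choose f hf using hcell
  set t := s'.filter fun b => b ∉ E with ht
  have htB : ∀ b ∈ t, b ∈ B := fun b hb => h1.1 b (Multiset.mem_of_mem_filter hb)
  -- With |det σ| such terms in one cell, some of them would sum into the lattice of σ and could be
  -- traded for no more elements of σ, all in `E`.
  have hlt : ∀ σ ∈ 𝒯, (t.map f).count σ + 1 ≤ (Matrix.of σ).det.natAbs := by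
    intro σ hσ
    by_contra! hcon
    rw [Multiset.count_map] at hcon
    obtain ⟨hσE, hli, φ, hφσ, hφE⟩ := h𝒯 σ hσ
    obtain ⟨u, hu, hu0, c, hc⟩ := exists_submultiset_sum_mem_lattice hli
      (t.filter fun b => σ = f b) (by omega)
    have hut : u ≤ t := hu.trans (Multiset.filter_le _ _)
    obtain ⟨v, hv, hvs, hvc⟩ := exists_multiset_of_sum_mem_lattice hli hφσ u (fun b hb => by
      have hb' := Multiset.mem_filter.1 (Multiset.mem_of_le hu hb)
      refine ⟨le_one_of_mem_hull_insert hφE (hB b (htB b hb'.1)), ?_⟩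
      rw [hb'.2]
      exact (hf b (htB b hb'.1)).2) hc
    obtain ⟨r, hr⟩ := Multiset.le_iff_exists_add.1 (hut.trans (Multiset.filter_le _ s'))
    have hvE : ∀ b ∈ v, b ∈ E := fun b hb => by
      obtain ⟨i, rfl⟩ := hv b hb
      exact hσE i
    have hrvB : ∀ b ∈ r + v, b ∈ B := by
      intro b hb
      rcases Multiset.mem_add.1 hb with h | h
      · exact h1.1 b (hr ▸ Multiset.mem_add.2 (Or.inr h))
      · exact hEB (hvE b h)
    have hrvs : (r + v).sum = s'.sum := by
      rw [hr, Multiset.sum_add, Multiset.sum_add, hvs, add_comm]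
    have hrvc : (r + v).card ≤ s'.card := by
      rw [hr, Multiset.card_add, Multiset.card_add]
      omega
    have hle := h3 (r + v) ⟨⟨hrvB, fun s'' h h' => hrvc.trans (h1.2 s'' h (h'.trans hrvs))⟩,
      hrvs.trans h2⟩
    have hvf : v.filter (fun b => b ∉ E) = 0 :=
      Multiset.filter_eq_nil.2 fun b hb => not_not.2 (hvE b hb)
    have huf : u.filter (fun b => b ∉ E) = u :=
      Multiset.filter_eq_self.2 fun b hb => (Multiset.mem_filter.1 (Multiset.mem_of_le hut hb)).2
    have hupos := Multiset.card_pos.2 hu0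
    rw [ht, hr, Multiset.filter_add, Multiset.filter_add, hvf, huf, Multiset.card_add,
      Multiset.card_add, Multiset.card_zero] at hle
    omega
  have hsum : ∑ σ ∈ 𝒯, (t.map f).count σ = t.card := by
    rw [Multiset.sum_count_eq_card, Multiset.card_map]
    intro σ hσ
    obtain ⟨b, hb, rfl⟩ := Multiset.mem_map.1 hσ
    exact (hf b (htB b hb)).1
  -- One term is saved per cell, and there is at least one cell.
  have hne : 1 ≤ 𝒯.card := Finset.card_pos.2 ⟨_, (hf 0 h0).1⟩
  have h4 := Finset.sum_le_sum hlt
  rw [Finset.sum_add_distrib, hsum, Finset.sum_const, smul_eq_mul, mul_one] at h4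
  have h5 : t.card + 1 ≤ ∑ σ ∈ 𝒯, (Matrix.of σ).det.natAbs := by omega
  exact_mod_cast h5

/-! ### Facets, pyramid volumes and κ -/

/-- By Krein–Milman, since extreme points of a face are extreme in the hull and hence come from `A`.
This leaves finitely many possible facets. -/
theorem eq_convexHull_of_isExposed {A : Finset (Fin d → ℤ)} {F : Set (Fin d → ℝ)}
    (hF : IsExposed ℝ (hull A) F) :
    F = convexHull ℝ (toReal '' (A : Set (Fin d → ℤ)) ∩ F) := by
  have hconv : Convex ℝ F := hF.convex (convex_convexHull ℝ _)
  have hfin : (toReal '' (A : Set (Fin d → ℤ)) ∩ F).Finite :=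
    (A.finite_toSet.image toReal).inter_of_left F
  refine Set.Subset.antisymm ?_ (convexHull_min Set.inter_subset_right hconv)
  rw [← hfin.isClosed_convexHull ℝ |>.closure_eq]
  conv_lhs => rw [← closure_convexHull_extremePoints (hF.isCompact (isCompact_hull A)) hconv]
  refine closure_mono (convexHull_mono fun x hx => ⟨?_, hx.1⟩)
  exact extremePoints_convexHull_subset (hF.isExtreme.extremePoints_subset_extremePoints hx)

theorem finite_setOf_isFacet (A : Finset (Fin d → ℤ)) : {F | IsFacet A F}.Finite := by
  refine (((A.finite_toSet.image toReal).powerset).image (convexHull ℝ)).subset ?_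
  intro F hF
  exact ⟨_, Set.inter_subset_left, (eq_convexHull_of_isExposed hF.1).symm⟩

/-- The suprema in `kappa` need bounded sets, which finiteness of `A` and of its facets provides;
positivity keeps the infimum in the denominator nonzero. -/
theorem pyramidVol_ratio_le_kappa {A : Finset (Fin d → ℤ)} {F : Set (Fin d → ℝ)}
    (hF : IsFacet A F) (hpos : ∀ y ∈ A, toReal y ∉ F → 0 < pyramidVol F y) {x a : Fin d → ℤ}
    (hx : x ∈ A) (hxF : toReal x ∉ F) (ha : a ∈ A) (haF : toReal a ∉ F) :
    pyramidVol F x / pyramidVol F a ≤ kappa A := by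
  have hfin : (pyramidVols A F).Finite :=
    (A.finite_toSet.subset fun y hy => hy.1).image _
  have hne : (pyramidVols A F).Nonempty := ⟨_, a, ⟨ha, haF⟩, rfl⟩
  have hinf : 0 < sInf (pyramidVols A F) := by
    obtain ⟨y, hy, h⟩ := hne.csInf_mem hfin
    rw [← h]
    exact hpos y hy.1 hy.2
  have h1 : pyramidVol F x ≤ sSup (pyramidVols A F) :=
    le_csSup hfin.bddAbove ⟨x, ⟨hx, hxF⟩, rfl⟩
  have h2 : sInf (pyramidVols A F) ≤ pyramidVol F a :=
    csInf_le hfin.bddBelow ⟨a, ⟨ha, haF⟩, rfl⟩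
  have h3 : 0 ≤ pyramidVol F x := (hpos x hx hxF).le
  refine le_trans ?_ (le_csSup ((finite_setOf_isFacet A).image _).bddAbove ⟨F, hF, rfl⟩)
  exact div_le_div₀ (h3.trans h1) h1 hinf h2

/-- The volume of a pyramid over a subset of a hyperplane is proportional to the height of its
apex. -/
theorem pyramidVol_eq_mul {F : Set (Fin d → ℝ)} {φ : (Fin d → ℝ) →ₗ[ℝ] ℝ} {a x : Fin d → ℤ}
    (hF : ∀ y ∈ F, φ (toReal a - y) = 1) (hx : φ (toReal a - toReal x) ≤ 1) :
    pyramidVol F x = (1 - φ (toReal a - toReal x)) * pyramidVol F a := by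
  let v := toReal x - toReal a
  -- The map y ↦ y + (φ(y) - φ(a) + 1)(x - a) fixes the hyperplane of `F`, sends `a` to `x` and has
  -- determinant 1 - φ(a - x).
  let L : (Fin d → ℝ) →ₗ[ℝ] (Fin d → ℝ) := LinearMap.transvection φ v
  let k := (1 - φ (toReal a)) • v
  let T : (Fin d → ℝ) →ᵃ[ℝ] (Fin d → ℝ) := L.toAffineMap + AffineMap.const ℝ _ k
  have hT : ∀ y, T y = L y + k := fun y => rfl
  have hTF : ∀ y ∈ F, T y = y := by
    intro y hy
    have h1 := hF y hy
    rw [map_sub] at h1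
    rw [hT, LinearMap.transvection.apply, add_assoc, ← add_smul,
      show φ y + (1 - φ (toReal a)) = 0 by linarith, zero_smul, add_zero]
  have hTa : T (toReal a) = toReal x := by
    rw [hT, LinearMap.transvection.apply, add_assoc, ← add_smul]
    simp [v]
  have himg : convexHull ℝ (insert (toReal x) F) = T '' convexHull ℝ (insert (toReal a) F) := by
    rw [AffineMap.image_convexHull, Set.image_insert_eq, hTa]
    congr 2
    ext y
    constructor
    · intro hy
      exact ⟨y, hy, hTF y hy⟩
    · rintro ⟨z, hz, rfl⟩
      rwa [hTF z hz]
  have himg' : T '' convexHull ℝ (insert (toReal a) F) =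
      (fun y => y + k) '' (L '' convexHull ℝ (insert (toReal a) F)) := by
    rw [Set.image_image]
    rfl
  have hdet : LinearMap.det L = 1 - φ (toReal a - toReal x) := by
    rw [LinearMap.transvection.det]
    simp only [v, map_sub]
    ring
  rw [pyramidVol, himg, himg', Set.image_add_right, measure_preimage_add_right,
    Measure.addHaar_image_linearMap, hdet, ENNReal.toReal_mul, ENNReal.toReal_ofReal (abs_nonneg _),
    abs_of_nonneg (by linarith), pyramidVol]

/-- Heights above a facet are at most `κ(A)` times each other; here `φ (a - y) = 1` is the equation
of a hyperplane through a facet, normalised at the point `a` outside it. -/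
theorem one_sub_le_kappa (hd : 0 < d) {A : Finset (Fin d → ℤ)} {a : Fin d → ℤ} (ha : a ∈ A)
    {φ : (Fin d → ℝ) →ₗ[ℝ] ℝ} (hφ : ∀ x ∈ A, φ (toReal a - toReal x) ≤ 1)
    (hspan : Submodule.span ℝ {y | ∃ x ∈ A, y = toReal a - toReal x ∧ φ y = 1} = ⊤)
    {x : Fin d → ℤ} (hx : x ∈ A) :
    1 - φ (toReal a - toReal x) ≤ kappa A := by
  have : Nonempty (Fin d) := ⟨⟨0, hd⟩⟩
  set F : Set (Fin d → ℝ) := {y ∈ hull A | φ (toReal a - y) = 1} with hFdef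
  have hmem : ∀ x ∈ A, toReal x ∈ hull A := fun x hx => subset_convexHull ℝ _ ⟨x, hx, rfl⟩
  have hhull : ∀ y ∈ hull A, φ (toReal a) - 1 ≤ φ y := by
    intro y hy
    have : hull A ⊆ {y | φ (toReal a) - 1 ≤ φ y} := by
      refine convexHull_min ?_ (convex_halfSpace_ge φ.isLinear _)
      rintro _ ⟨x, hx, rfl⟩
      have := hφ x hx
      rw [map_sub] at this
      simp only [Set.mem_ofPred_eq]
      linarith
    exact this hy
  obtain ⟨x₀, hx₀, hφ₀⟩ : ∃ x₀ ∈ A, φ (toReal a - toReal x₀) = 1 := by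
    by_contra! hcon
    have : {y | ∃ x ∈ A, y = toReal a - toReal x ∧ φ y = 1} = ∅ := by
      rw [Set.eq_empty_iff_forall_notMem]
      rintro _ ⟨x, hx, rfl, h⟩
      exact hcon x hx h
    rw [this, Submodule.span_empty] at hspan
    exact bot_ne_top hspan
  have hx₀F : toReal x₀ ∈ F := ⟨hmem _ hx₀, hφ₀⟩
  have hexp : IsExposed ℝ (hull A) F := by
    intro _
    refine ⟨LinearMap.toContinuousLinearMap (-φ), ?_⟩
    ext y
    simp only [hFdef, LinearMap.coe_toContinuousLinearMap', LinearMap.neg_apply, neg_le_neg_iff,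
      Set.mem_ofPred_eq, map_sub]
    rw [map_sub] at hφ₀
    refine and_congr_right fun hy => ⟨fun h z hz => ?_, fun h => ?_⟩
    · linarith [hhull z hz]
    · linarith [hhull y hy, h _ (hmem _ hx₀)]
  have hvker : vectorSpan ℝ F ≤ LinearMap.ker φ := by
    rw [vectorSpan_def, Submodule.span_le]
    rintro _ ⟨y, hy, z, hz, rfl⟩
    have h1 := hy.2
    have h2 := hz.2
    rw [map_sub] at h1 h2
    simp only [vsub_eq_sub, SetLike.mem_coe, LinearMap.mem_ker, map_sub]
    linarith
  have hker : Module.finrank ℝ (LinearMap.ker φ) < d := by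
    have : LinearMap.ker φ < ⊤ := by
      rw [lt_top_iff_ne_top]
      intro h
      have h1 : toReal a - toReal x₀ ∈ LinearMap.ker φ := h ▸ trivial
      rw [LinearMap.mem_ker, hφ₀] at h1
      exact one_ne_zero h1
    simpa using Submodule.finrank_lt_finrank_of_lt this
  -- The spanning vectors a - x differ by directions of `F`; one of them together with these
  -- directions spans, so `F` has dimension at least d - 1.
  have hsup : Submodule.span ℝ {toReal a - toReal x₀} ⊔ vectorSpan ℝ F = ⊤ := by
    rw [← top_le_iff, ← hspan, Submodule.span_le]
    rintro _ ⟨x, hx, rfl, h⟩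
    have h1 : toReal a - toReal x = (toReal a - toReal x₀) + (toReal x₀ - toReal x) := by abel
    rw [h1]
    refine Submodule.add_mem_sup (Submodule.mem_span_singleton_self _) ?_
    exact vsub_mem_vectorSpan ℝ hx₀F ⟨hmem _ hx, h⟩
  have hfacet : IsFacet A F := by
    refine ⟨hexp, ⟨_, hx₀F⟩, le_antisymm ?_ ?_⟩
    · have := Submodule.finrank_mono hvker
      omega
    · have h1 := Submodule.finrank_add_le_finrank_add_finrank
        (Submodule.span ℝ {toReal a - toReal x₀}) (vectorSpan ℝ F)
      rw [hsup, finrank_top, Module.finrank_fin_fun] at h1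
      have h2 : Module.finrank ℝ (Submodule.span ℝ {toReal a - toReal x₀}) ≤ 1 := by
        simpa using finrank_span_le_card (R := ℝ) {toReal a - toReal x₀}
      omega
  have haF : toReal a ∉ F := fun h => by
    have := h.2
    simp at this
  have hposa : 0 < pyramidVol F a := by
    have haff : affineSpan ℝ (insert (toReal a) F) = ⊤ := by
      rw [AffineSubspace.affineSpan_eq_top_iff_vectorSpan_eq_top_of_nonempty ℝ _ _
        (Set.insert_nonempty _ _), ← top_le_iff, ← hspan, Submodule.span_le]
      rintro _ ⟨x, hx, rfl, h⟩
      exact vsub_mem_vectorSpan ℝ (Set.mem_insert _ _) (Set.mem_insert_of_mem _ ⟨hmem _ hx, h⟩)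
    have hint := interior_convexHull_nonempty_iff_affineSpan_eq_top.2 haff
    refine ENNReal.toReal_pos ?_ ?_
    · exact (isOpen_interior.measure_pos volume hint |>.trans_le
        (measure_mono interior_subset)).ne'
    · refine ((measure_mono ?_).trans_lt (isCompact_hull A).measure_lt_top).ne
      refine convexHull_min ?_ (convex_convexHull ℝ _)
      rintro y (rfl | hy)
      · exact hmem a ha
      · exact hy.1
  have hvol : ∀ y ∈ A, pyramidVol F y = (1 - φ (toReal a - toReal y)) * pyramidVol F a :=
    fun y hy => pyramidVol_eq_mul (fun z hz => hz.2) (hφ y hy)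
  have hpos : ∀ y ∈ A, toReal y ∉ F → 0 < pyramidVol F y := by
    intro y hy hyF
    rw [hvol y hy]
    refine mul_pos (sub_pos.2 (lt_of_le_of_ne (hφ y hy) fun h => hyF ⟨hmem _ hy, h⟩)) hposa
  -- On the facet the height is 0, and the ratio of `a` to itself shows that κ is at least 1.
  by_cases hxF : toReal x ∈ F
  · have h1 := pyramidVol_ratio_le_kappa hfacet hpos ha haF ha haF
    rw [div_self hposa.ne'] at h1
    have h2 := hxF.2
    linarith
  · have h1 := pyramidVol_ratio_le_kappa hfacet hpos hx hxF ha haF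
    rwa [hvol x hx, mul_div_cancel_right₀ _ hposa.ne'] at h1

/-! ### Multisets, sumsets and the reflected sets a - A -/

theorem mem_nfold_iff {N : ℕ} {A : Finset (Fin d → ℤ)} {v : Fin d → ℤ} :
    v ∈ nfold N A ↔ ∃ s : Multiset (Fin d → ℤ), s.card = N ∧ (∀ b ∈ s, b ∈ A) ∧ s.sum = v := by
  constructor
  · rintro ⟨f, hf, rfl⟩
    refine ⟨Finset.univ.val.map f, by simp, fun b hb => ?_, rfl⟩
    obtain ⟨i, -, rfl⟩ := Multiset.mem_map.1 hb
    exact hf i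
  · rintro ⟨s, hc, hs, rfl⟩
    obtain ⟨l, rfl⟩ := Quot.exists_rep s
    have hl : l.length = N := hc
    subst hl
    refine ⟨l.get, fun i => hs _ (List.get_mem l i), ?_⟩
    change l.sum = _
    rw [← List.sum_ofFn, List.ofFn_get]

theorem mem_reflect {a y : Fin d → ℤ} {A : Finset (Fin d → ℤ)} :
    y ∈ reflect a A ↔ ∃ x ∈ A, a - x = y := by
  simp [reflect]

theorem sub_mem_of_mem_reflect {a y : Fin d → ℤ} {A : Finset (Fin d → ℤ)}
    (hy : y ∈ reflect a A) : a - y ∈ A := by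
  obtain ⟨x, hx, rfl⟩ := mem_reflect.1 hy
  simpa using hx

theorem ex_subset (A : Finset (Fin d → ℤ)) : ex A ⊆ A := fun _ h => (mem_ex.1 h).1

theorem hull_ex (A : Finset (Fin d → ℤ)) : hull (ex A) = hull A := by
  have h := closure_convexHull_extremePoints (isCompact_hull A) (convex_convexHull ℝ _)
  rw [← image_ex] at h
  rw [← h]
  exact (isCompact_hull (ex A)).isClosed.closure_eq.symm

theorem hull_reflect (a : Fin d → ℤ) (A : Finset (Fin d → ℤ)) :
    hull (reflect a A) = (fun y => toReal a - y) '' hull A := by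
  let T : (Fin d → ℝ) →ᵃ[ℝ] (Fin d → ℝ) := AffineMap.const ℝ _ (toReal a) - AffineMap.id ℝ _
  have hT : (fun y => toReal a - y) = T := rfl
  rw [hT, hull, hull, AffineMap.image_convexHull, Set.image_image]
  congr 1
  rw [reflect, Finset.coe_image, Set.image_image]
  refine Set.image_congr fun x _ => ?_
  rw [toReal_sub]
  rfl

theorem vol_reflect (a : Fin d → ℤ) (A : Finset (Fin d → ℤ)) : vol (reflect a A) = vol A := by
  rw [vol, vol, hull_reflect]
  congr 1
  rw [show (fun y => toReal a - y) '' hull A = (fun y => toReal a - y) ⁻¹' hull A by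
    ext z
    constructor
    · rintro ⟨y, hy, rfl⟩
      simpa using hy
    · intro hz
      exact ⟨_, hz, by simp⟩]
  exact (Measure.measurePreserving_sub_left volume (toReal a)).measure_preimage
    (isCompact_hull A).measurableSet.nullMeasurableSet

theorem span_reflect_eq_top {A : Finset (Fin d → ℤ)} {a : Fin d → ℤ} (h0 : 0 ∈ A)
    (hA : AddSubgroup.closure (A : Set (Fin d → ℤ)) = ⊤) :
    Submodule.span ℝ (toReal '' (reflect a A : Set (Fin d → ℤ))) = ⊤ := by
  set W := Submodule.span ℝ (toReal '' (reflect a A : Set (Fin d → ℤ)))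
  have hmem : ∀ x ∈ A, toReal a - toReal x ∈ W := fun x hx => by
    rw [← toReal_sub]
    exact Submodule.subset_span ⟨_, Finset.mem_coe.2 (mem_reflect.2 ⟨x, hx, rfl⟩), rfl⟩
  have hAW : ∀ x ∈ A, toReal x ∈ W := fun x hx => by
    have := sub_mem (hmem 0 h0) (hmem x hx)
    simpa [toReal_zero] using this
  have hall : ∀ x : Fin d → ℤ, toReal x ∈ W := fun x => by
    have hx : x ∈ AddSubgroup.closure (A : Set (Fin d → ℤ)) := hA ▸ trivial
    induction hx using AddSubgroup.closure_induction with
    | mem x hx => exact hAW x hx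
    | zero => rw [toReal_zero]; exact zero_mem _
    | add x y _ _ hx hy => rw [toReal_add]; exact add_mem hx hy
    | neg x _ hx =>
      have : toReal (-x) = -toReal x := by ext; simp [toReal]
      rw [this]
      exact neg_mem hx
  rw [← top_le_iff, ← (Pi.basisFun ℝ (Fin d)).span_eq, Submodule.span_le]
  rintro _ ⟨i, rfl⟩
  have : (Pi.basisFun ℝ (Fin d)) i = toReal (Pi.single i 1) := by
    ext j
    simp [toReal, Pi.single_apply]
  rw [this]
  exact hall _

theorem span_eq_top_of_subset_hull {E B : Finset (Fin d → ℤ)}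
    (hB : ∀ b ∈ B, toReal b ∈ hull (insert 0 E))
    (hspan : Submodule.span ℝ (toReal '' (B : Set (Fin d → ℤ))) = ⊤) :
    Submodule.span ℝ (toReal '' (E : Set (Fin d → ℤ))) = ⊤ := by
  rw [← top_le_iff, ← hspan, Submodule.span_le]
  rintro _ ⟨b, hb, rfl⟩
  obtain ⟨c, -, hc⟩ := mem_cone_of_mem_hull_insert (hB b hb)
  rw [hc]
  exact Submodule.sum_mem _ fun e he =>
    Submodule.smul_mem _ _ (Submodule.subset_span ⟨e, he, rfl⟩)

theorem natAbs_det_le_volDagMax {A : Finset (Fin d → ℤ)} {a : Fin d → ℤ} (ha : a ∈ A)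
    (p : Fin d → Fin d → ℤ) (hp : ∀ i, p i ∈ reflect a A) :
    (Matrix.of p).det.natAbs ≤ volDagMax A := by
  let q : Fin (d + 1) → Fin d → ℤ := Fin.cons a fun i => a - p i
  have hq : q ∈ Fintype.piFinset fun _ : Fin (d + 1) => A := by
    rw [Fintype.mem_piFinset]
    intro i
    refine Fin.cases ?_ (fun j => ?_) i
    · exact ha
    · exact sub_mem_of_mem_reflect (hp j)
  refine le_trans (le_of_eq ?_) (Finset.le_sup (f := fun p : Fin (d + 1) → Fin d → ℤ =>
    (Matrix.of fun i j : Fin d => p j.succ i - p 0 i).det.natAbs) hq)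
  have : (Matrix.of fun i j : Fin d => q j.succ i - q 0 i) = -(Matrix.of p).transpose := by
    ext i j
    simp [q]
  simp only [this, Matrix.det_neg, Matrix.det_transpose, Int.natAbs_mul, Int.natAbs_pow,
    Int.natAbs_neg, Int.natAbs_one, one_pow, one_mul]

/-- A cell of the triangulation has a nonzero integer determinant. This permits the natural
subtraction `D - 1` later. -/
theorem one_le_of_forall_natAbs_det_le {E : Finset (Fin d → ℤ)}
    (hE : Submodule.span ℝ (toReal '' (E : Set (Fin d → ℤ))) = ⊤) {D : ℕ}
    (hD : ∀ p : Fin d → Fin d → ℤ, (∀ i, p i ∈ insert 0 E) → (Matrix.of p).det.natAbs ≤ D) :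
    1 ≤ D := by
  obtain ⟨𝒯, h1, h2, -⟩ := exists_star_triangulation hE
  obtain ⟨σ, hσ, -⟩ := h2 0 ⟨0, fun _ _ => le_rfl, by simp⟩
  have h3 := Int.natAbs_ne_zero.2 (det_ne_zero_of_linearIndependent (h1 σ hσ).2.1)
  have h4 := hD σ fun i => Finset.mem_insert_of_mem ((h1 σ hσ).1 i)
  omega

/-! ### Length of shortest representations -/

/-- The number of elements of `E` in a multiset that miss a facet containing all elements of
multiplicity at least `D`. -/
theorem card_filter_ne_one_le {E : Finset (Fin d → ℤ)} {φ : (Fin d → ℝ) →ₗ[ℝ] ℝ}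
    (hφ : IsVertex (fun e : E => toReal (e : Fin d → ℤ)) (fun _ => 1) φ) {D : ℕ} (hD1 : 1 ≤ D)
    (s : Multiset (Fin d → ℤ)) [DecidablePred fun b => φ (toReal b) ≠ 1]
    (hD : ∀ e ∈ E, D ≤ s.count e → φ (toReal e) = 1) :
    ((s.filter fun b => φ (toReal b) ≠ 1).card : ℝ) ≤
      ((E.card : ℝ) - d) * ((D : ℝ) - 1) + (s.filter fun b => b ∉ E).card := by
  classical
  set Q := E.filter fun e => φ (toReal e) ≠ 1 with hQ
  set R := E.filter fun e => φ (toReal e) = 1 with hR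
  -- The elements on the facet span, because `φ` is a vertex.
  have hRd : d ≤ R.card := by
    have h1 : (⊤ : Submodule ℝ (Fin d → ℝ)) ≤ Submodule.span ℝ (R.image toReal : Finset _) := by
      rw [← hφ.2]
      refine Submodule.span_mono ?_
      rintro _ ⟨⟨e, he⟩, h, rfl⟩
      exact Finset.mem_coe.2 (Finset.mem_image_of_mem _ (Finset.mem_filter.2 ⟨he, h⟩))
    have h2 := finrank_span_finset_le_card (R := ℝ) (R.image toReal)
    rw [Set.finrank, top_le_iff.1 h1, finrank_top, Module.finrank_fin_fun] at h2
    exact h2.trans Finset.card_image_le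
  have hQR : R.card + Q.card = E.card := Finset.card_filter_add_card_filter_not _
  have hsum : ((s.filter fun b => φ (toReal b) ≠ 1).filter (· ∈ E)).card =
      ∑ e ∈ Q, s.count e := by
    rw [← Multiset.sum_count_eq_card (s := Q)]
    · refine Finset.sum_congr rfl fun e he => ?_
      have := Finset.mem_filter.1 he
      rw [Multiset.count_filter_of_pos this.1, Multiset.count_filter_of_pos (p := fun b => φ (toReal b) ≠ 1) this.2]
    · intro e he
      have h1 := Multiset.mem_filter.1 he
      exact Finset.mem_filter.2 ⟨h1.2, (Multiset.mem_filter.1 h1.1).2⟩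
  have hle : ((s.filter fun b => φ (toReal b) ≠ 1).filter fun b => ¬ b ∈ E).card ≤
      (s.filter fun b => b ∉ E).card :=
    Multiset.card_le_card (Multiset.filter_le_filter _ (Multiset.filter_le _ _))
  have hsplit := congrArg Multiset.card
    (Multiset.filter_add_not (· ∈ E) (s.filter fun b => φ (toReal b) ≠ 1))
  rw [Multiset.card_add, hsum] at hsplit
  have hcount : ∑ e ∈ Q, s.count e ≤ Q.card * (D - 1) := by
    rw [← smul_eq_mul]
    refine Finset.sum_le_card_nsmul _ _ _ fun e he => ?_
    have h1 := Finset.mem_filter.1 he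
    have h2 : ¬ D ≤ s.count e := fun h => h1.2 (hD e h1.1 h)
    omega
  have h1 : ((s.filter fun b => φ (toReal b) ≠ 1).card : ℝ) ≤
      Q.card * ((D : ℝ) - 1) + (s.filter fun b => b ∉ E).card := by
    have : (s.filter fun b => φ (toReal b) ≠ 1).card ≤
      Q.card * (D - 1) + (s.filter fun b => b ∉ E).card := by omega
    calc ((s.filter fun b => φ (toReal b) ≠ 1).card : ℝ)
        ≤ ((Q.card * (D - 1) + (s.filter fun b => b ∉ E).card : ℕ) : ℝ) := by exact_mod_cast this
      _ = _ := by
        push_cast [Nat.cast_sub hD1]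
        rfl
  have h2 : (Q.card : ℝ) ≤ E.card - d := by
    have : Q.card + d ≤ E.card := by omega
    have h3 : ((Q.card + d : ℕ) : ℝ) ≤ E.card := by exact_mod_cast this
    push_cast at h3
    linarith
  have h3 : (0 : ℝ) ≤ (D : ℝ) - 1 := by
    have : (1 : ℝ) ≤ D := by exact_mod_cast hD1
    linarith
  have := mul_le_mul_of_nonneg_right h2 h3
  linarith

/-- The cardinality is the sum of φ(b) + (1 - φ(b)) over the terms, and the second summand vanishes
where φ(b) = 1. -/
theorem card_le_apply_sum_add {φ : (Fin d → ℝ) →ₗ[ℝ] ℝ} {κ : ℝ} (s : Multiset (Fin d → ℤ))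
    [DecidablePred fun b => φ (toReal b) ≠ 1] (hs : ∀ b ∈ s, 1 - φ (toReal b) ≤ κ) :
    (s.card : ℝ) ≤
      φ (toReal s.sum) + κ * (s.filter fun b => φ (toReal b) ≠ 1).card := by
  induction s using Multiset.induction_on with
  | empty => simp [toReal_zero]
  | cons a s ih =>
    have h1 := ih fun b hb => hs b (Multiset.mem_cons_of_mem hb)
    have h2 := hs a (Multiset.mem_cons_self a s)
    rw [Multiset.sum_cons, toReal_add, map_add, Multiset.card_cons]
    by_cases h : φ (toReal a) = 1
    · rw [Multiset.filter_cons_of_neg (p := fun b => φ (toReal b) ≠ 1) _ (not_not.2 h), h]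
      push_cast
      linarith
    · rw [Multiset.filter_cons_of_pos (p := fun b => φ (toReal b) ≠ 1) _ h, Multiset.card_cons]
      push_cast
      linarith

/-- Every sum of elements of `a - A`, for `a` an extreme point, is a sum of at most `φ + κ(A) K`
elements, where `φ` is its height with respect to some facet avoiding the origin. -/
def HasShortSums (A : Finset (Fin d → ℤ)) (K : ℝ) : Prop :=
  ∀ a ∈ ex A, ∀ s : Multiset (Fin d → ℤ), (∀ b ∈ s, b ∈ reflect a A) →
    ∃ s' : Multiset (Fin d → ℤ), (∀ b ∈ s', b ∈ reflect a A) ∧ s'.sum = s.sum ∧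
      ∃ φ : (Fin d → ℝ) →ₗ[ℝ] ℝ, (∀ x ∈ A, φ (toReal a - toReal x) ≤ 1) ∧
        (s'.card : ℝ) ≤ φ (toReal s.sum) + kappa A * K

/-- The common core of both estimates: `E` is either all nonzero elements of a - A or only its
nonzero extreme points, and `r` bounds the terms outside it. -/
theorem exists_card_le_of_isShortest (hd : 0 < d) {A E : Finset (Fin d → ℤ)} {a : Fin d → ℤ}
    (ha : a ∈ A) (hEA : insert 0 E ⊆ reflect a A)
    (hspan : Submodule.span ℝ (toReal '' (reflect a A : Set (Fin d → ℤ))) = ⊤)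
    (hhull : ∀ b ∈ reflect a A, toReal b ∈ hull (insert 0 E)) {s : Multiset (Fin d → ℤ)}
    (hs : IsShortest (reflect a A) s) {r : ℝ}
    (hr : ((s.filter fun b => b ∉ E).card : ℝ) ≤ r) :
    1 ≤ kappa A ∧ ∃ φ : (Fin d → ℝ) →ₗ[ℝ] ℝ, (∀ x ∈ A, φ (toReal a - toReal x) ≤ 1) ∧
      (s.card : ℝ) ≤ φ (toReal s.sum) +
        kappa A * (((E.card : ℝ) - d) * ((volDagMax A : ℝ) - 1) + r) := by
  classical
  have hE := span_eq_top_of_subset_hull hhull hspan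
  have hD : ∀ p : Fin d → Fin d → ℤ, (∀ i, p i ∈ insert 0 E) →
      (Matrix.of p).det.natAbs ≤ volDagMax A := fun p hp =>
    natAbs_det_le_volDagMax ha p fun i => hEA (hp i)
  obtain ⟨φ, hφ, hφD⟩ := exists_isVertex_of_card_min (D := volDagMax A) hE hD s
    (fun s' h1 h2 => hs.2 s' (fun b hb => (h1 b hb).elim (hs.1 b) fun h => hEA h) h2)
  have hφ1 : ∀ x ∈ A, φ (toReal a - toReal x) ≤ 1 := fun x hx => by
    rw [← toReal_sub]
    refine le_one_of_mem_hull_insert (E := E) (fun e he => hφ.1 ⟨e, he⟩) ?_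
    exact hhull _ (mem_reflect.2 ⟨x, hx, rfl⟩)
  have hκ : ∀ x ∈ A, 1 - φ (toReal a - toReal x) ≤ kappa A := fun x hx => by
    refine one_sub_le_kappa hd ha hφ1 ?_ hx
    rw [← top_le_iff, ← hφ.2]
    refine Submodule.span_mono ?_
    rintro _ ⟨⟨e, he⟩, h, rfl⟩
    refine ⟨a - e, sub_mem_of_mem_reflect (hEA (Finset.mem_insert_of_mem he)), ?_, h⟩
    rw [toReal_sub]
    abel
  have hκ1 : 1 ≤ kappa A := by simpa using hκ a ha
  refine ⟨hκ1, φ, hφ1, ?_⟩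
  have h1 := card_le_apply_sum_add (φ := φ) (κ := kappa A) s (fun b hb => by
    have := hκ _ (sub_mem_of_mem_reflect (hs.1 b hb))
    rwa [toReal_sub, sub_sub_cancel] at this)
  have hD1 : 1 ≤ volDagMax A := one_le_of_forall_natAbs_det_le hE hD
  have h2 := card_filter_ne_one_le hφ hD1 s (fun e he h => hφD e he h)
  have h3 := mul_le_mul_of_nonneg_left (h2.trans (add_le_add_right hr _)) (by linarith : 0 ≤ kappa A)
  linarith

theorem kappa_of_dim_zero (A : Finset (Fin 0 → ℤ)) : kappa A = 0 := by
  have : {F : Set (Fin 0 → ℝ) | IsFacet A F} = ∅ := by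
    rw [Set.eq_empty_iff_forall_notMem]
    rintro F ⟨-, -, h⟩
    omega
  rw [kappa, this, Set.image_empty, Real.sSup_empty]

theorem hasShortSums_of_dim_zero (A : Finset (Fin 0 → ℤ)) (K : ℝ) : HasShortSums A K := by
  intro a _ s _
  exact ⟨0, by simp, Subsingleton.elim _ _, 0, by simp, by simp [kappa_of_dim_zero]⟩

/-- A shortest representation never uses 0, so with E = (a - A) \ {0} no term lies outside `E`. -/
theorem exists_card_le_of_isShortest_erase (hd : 0 < d) {A : Finset (Fin d → ℤ)} (h0 : 0 ∈ A)
    (hA : AddSubgroup.closure (A : Set (Fin d → ℤ)) = ⊤) {a : Fin d → ℤ} (ha : a ∈ A)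
    {s : Multiset (Fin d → ℤ)} (hs : IsShortest (reflect a A) s) :
    1 ≤ kappa A ∧ ∃ φ : (Fin d → ℝ) →ₗ[ℝ] ℝ, (∀ x ∈ A, φ (toReal a - toReal x) ≤ 1) ∧
      (s.card : ℝ) ≤ φ (toReal s.sum) +
        kappa A * (((A.card : ℝ) - d - 1) * ((volDagMax A : ℝ) - 1)) := by
  have h0B : (0 : Fin d → ℤ) ∈ reflect a A := mem_reflect.2 ⟨a, ha, sub_self a⟩
  have hins : insert 0 ((reflect a A).erase 0) = reflect a A := Finset.insert_erase h0B
  obtain ⟨hκ, φ, h1, h2⟩ := exists_card_le_of_isShortest hd ha (E := (reflect a A).erase 0)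
    hins.subset (span_reflect_eq_top h0 hA) (fun b hb => by
      rw [hins]
      exact subset_convexHull ℝ _ ⟨b, hb, rfl⟩) hs (r := 0) (by
      rw [Multiset.filter_eq_nil.2]
      · simp
      · intro b hb
        rw [not_not]
        exact Finset.mem_erase.2 ⟨fun h => hs.zero_notMem (h ▸ hb), hs.1 b hb⟩)
  refine ⟨hκ, φ, h1, ?_⟩
  have hcard : (((reflect a A).erase 0).card : ℝ) = A.card - 1 := by
    have h3 := Finset.card_erase_add_one h0B
    have h4 : (reflect a A).card = A.card :=
      Finset.card_image_of_injective _ sub_right_injective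
    rw [h4] at h3
    rw [← h3]
    push_cast
    ring
  rw [hcard, add_zero] at h2
  convert h2 using 4
  ring

theorem one_le_kappa (hd : 0 < d) {A : Finset (Fin d → ℤ)} (h0 : 0 ∈ A)
    (hA : AddSubgroup.closure (A : Set (Fin d → ℤ)) = ⊤) : 1 ≤ kappa A :=
  (exists_card_le_of_isShortest_erase hd h0 hA h0 (s := 0)
    ⟨by simp, fun _ _ _ => Nat.zero_le _⟩).1

theorem hasShortSums_card {A : Finset (Fin d → ℤ)} (h0 : 0 ∈ A)
    (hA : AddSubgroup.closure (A : Set (Fin d → ℤ)) = ⊤) :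
    HasShortSums A (((A.card : ℝ) - d - 1) * ((volDagMax A : ℝ) - 1)) := by
  rcases Nat.eq_zero_or_pos d with rfl | hd
  · exact hasShortSums_of_dim_zero _ _
  intro a haex s hs
  obtain ⟨s', hs', hsum⟩ := exists_isShortest s hs
  obtain ⟨-, φ, h1, h2⟩ := exists_card_le_of_isShortest_erase hd h0 hA (ex_subset A haex) hs'
  exact ⟨s', hs'.1, hsum, φ, h1, hsum ▸ h2⟩

/-- Here `E` consists of the nonzero extreme points of a - A; the triangulation bound controls the
terms outside it. -/
theorem hasShortSums_ex {A : Finset (Fin d → ℤ)} (h0 : 0 ∈ A)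
    (hA : AddSubgroup.closure (A : Set (Fin d → ℤ)) = ⊤) :
    HasShortSums A ((((ex A).card : ℝ) - d - 1) * ((volDagMax A : ℝ) - 1) +
      (d.factorial * vol A - 1)) := by
  rcases Nat.eq_zero_or_pos d with rfl | hd
  · exact hasShortSums_of_dim_zero _ _
  intro a haex s hs
  have ha := ex_subset A haex
  have h0B : (0 : Fin d → ℤ) ∈ reflect a A := mem_reflect.2 ⟨a, ha, sub_self a⟩
  have h0E : (0 : Fin d → ℤ) ∈ reflect a (ex A) := mem_reflect.2 ⟨a, haex, sub_self a⟩
  have hsub : reflect a (ex A) ⊆ reflect a A := Finset.image_subset_image (ex_subset A)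
  have hins : insert 0 ((reflect a (ex A)).erase 0) = reflect a (ex A) := Finset.insert_erase h0E
  have hhull : ∀ b ∈ reflect a A, toReal b ∈ hull (insert 0 ((reflect a (ex A)).erase 0)) := by
    intro b hb
    rw [hins, hull_reflect, hull_ex, ← hull_reflect]
    exact subset_convexHull ℝ _ ⟨b, hb, rfl⟩
  have hspan := span_reflect_eq_top (a := a) h0 hA
  obtain ⟨s', hs', hsum, hr⟩ := exists_isShortest_filter_card_lt
    ((Finset.erase_subset _ _).trans hsub) h0B
    (span_eq_top_of_subset_hull hhull hspan) hhull s hs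
  rw [vol_reflect] at hr
  obtain ⟨-, φ, h1, h2⟩ := exists_card_le_of_isShortest hd ha
    (E := (reflect a (ex A)).erase 0) (hins.subset.trans hsub) hspan
    hhull hs' (r := d.factorial * vol A - 1) (by linarith)
  refine ⟨s', hs'.1, hsum, φ, h1, ?_⟩
  have hcard : (((reflect a (ex A)).erase 0).card : ℝ) = (ex A).card - 1 := by
    have h3 := Finset.card_erase_add_one h0E
    have h4 : (reflect a (ex A)).card = (ex A).card :=
      Finset.card_image_of_injective _ sub_right_injective
    rw [h4] at h3
    rw [← h3]
    push_cast
    ring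
  rw [hsum, hcard] at h2
  convert h2 using 5
  ring

/-! ### The structural equation and its threshold -/

theorem toReal_mem_smul_hull {A : Finset (Fin d → ℤ)} (hA : A.Nonempty)
    (s : Multiset (Fin d → ℤ)) (hs : ∀ b ∈ s, b ∈ A) :
    toReal s.sum ∈ (s.card : ℝ) • hull A := by
  have hconv : Convex ℝ (hull A) := convex_convexHull ℝ _
  induction s using Multiset.induction_on with
  | empty =>
    obtain ⟨a, ha⟩ := hA
    exact ⟨toReal a, subset_convexHull ℝ _ ⟨a, ha, rfl⟩, by simp [toReal_zero]⟩
  | cons a s ih =>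
    rw [Multiset.sum_cons, toReal_add, Multiset.card_cons, Nat.cast_add, Nat.cast_one,
      add_comm (toReal a), hconv.add_smul (Nat.cast_nonneg _) zero_le_one, one_smul]
    exact Set.add_mem_add (ih fun b hb => hs b (Multiset.mem_cons_of_mem hb))
      (subset_convexHull ℝ _ ⟨a, hs a (Multiset.mem_cons_self a s), rfl⟩)

theorem nfold_subset {A : Finset (Fin d → ℤ)} (hA : A.Nonempty) (N : ℕ) :
    nfold N A ⊆ {v | toReal v ∈ (N : ℝ) • hull A} \
      ⋃ a ∈ ex A, (fun e => N • a - e) '' exceptional (reflect a A) := by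
  intro v hv
  obtain ⟨s, rfl, hs, rfl⟩ := mem_nfold_iff.1 hv
  refine ⟨toReal_mem_smul_hull hA s hs, fun h => ?_⟩
  simp only [Set.mem_iUnion] at h
  obtain ⟨a, ha, e, he, hv⟩ := h
  apply he.2
  simp only [semigroup, Set.mem_iUnion]
  -- The additional summand 0 = a - a handles N = 0, since `semigroup` requires at least one
  -- summand.
  refine ⟨s.card + 1, Nat.le_add_left 1 _, mem_nfold_iff.2
    ⟨0 ::ₘ s.map fun b => a - b, by simp, fun b hb => ?_, ?_⟩⟩
  · rcases Multiset.mem_cons.1 hb with rfl | hb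
    · exact mem_reflect.2 ⟨a, ex_subset A ha, sub_self a⟩
    · obtain ⟨c, hc, rfl⟩ := Multiset.mem_map.1 hb
      exact mem_reflect.2 ⟨c, hs c hc, rfl⟩
  · have hv' : e = s.card • a - s.sum := by
      rw [← hv]
      exact (sub_sub_cancel _ _).symm
    rw [Multiset.sum_cons, zero_add, Multiset.sum_map_sub, Multiset.map_const', Multiset.map_id',
      Multiset.sum_replicate, hv']

/-- A point of `N H(A)` has weight at least `N / (d + 1)` on some extreme point. -/
theorem exists_ex_heavy {A : Finset (Fin d → ℤ)} {y : Fin d → ℝ} (hy : y ∈ hull A) :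
    ∃ a ∈ ex A, ∀ φ : (Fin d → ℝ) →ₗ[ℝ] ℝ, (∀ x ∈ A, φ (toReal a - toReal x) ≤ 1) →
      φ (toReal a - y) ≤ 1 - 1 / ((d : ℝ) + 1) := by
  rw [← hull_ex] at hy
  obtain ⟨ι, _, z, w, hz, hind, hw, hw1, rfl⟩ := eq_pos_convex_span_of_mem_convexHull hy
  have hcard : Fintype.card ι ≤ d + 1 := by
    refine hind.card_le_finrank_succ.trans ?_
    have := Submodule.finrank_le (vectorSpan ℝ (Set.range z))
    simp only [Module.finrank_fin_fun] at this
    omega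
  -- At most d + 1 weights add up to 1. In a - y the point a = x i drops out, leaving total weight 1
  -- - w i.
  obtain ⟨i, hi⟩ : ∃ i, 1 / ((d : ℝ) + 1) ≤ w i := by
    by_contra! hcon
    have hne : (Finset.univ : Finset ι).Nonempty := by
      rw [Finset.nonempty_iff_ne_empty]
      intro h
      rw [h] at hw1
      simp at hw1
    have h1 := Finset.sum_lt_sum_of_nonempty hne fun i _ => hcon i
    rw [hw1, Finset.sum_const, nsmul_eq_mul, Finset.card_univ] at h1
    have h2 : (Fintype.card ι : ℝ) ≤ (d : ℝ) + 1 := by exact_mod_cast hcard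
    have h3 := mul_le_mul_of_nonneg_right h2 (by positivity : 0 ≤ 1 / ((d : ℝ) + 1))
    rw [mul_one_div_cancel (by positivity)] at h3
    linarith
  have hz' : ∀ j, ∃ x ∈ ex A, toReal x = z j := fun j => hz ⟨j, rfl⟩
  choose x hx hxz using hz'
  refine ⟨x i, hx i, fun φ hφ => ?_⟩
  classical
  have h1 : toReal (x i) - ∑ j, w j • z j = ∑ j, w j • (toReal (x i) - toReal (x j)) := by
    simp_rw [smul_sub, Finset.sum_sub_distrib]
    rw [← Finset.sum_smul, hw1, one_smul]
    simp_rw [hxz]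
  rw [h1, map_sum, ← Finset.add_sum_erase _ _ (Finset.mem_univ i), sub_self, smul_zero, map_zero,
    zero_add]
  have h2 : ∑ j ∈ Finset.univ.erase i, φ (w j • (toReal (x i) - toReal (x j))) ≤
      ∑ j ∈ Finset.univ.erase i, w j := by
    refine Finset.sum_le_sum fun j _ => ?_
    rw [map_smul, smul_eq_mul]
    exact mul_le_of_le_one_right (hw j).le (hφ _ (ex_subset A (hx j)))
  have h3 := Finset.add_sum_erase Finset.univ w (Finset.mem_univ i)
  linarith

theorem HasShortSums.structureEq {A : Finset (Fin d → ℤ)} (hA : A.Nonempty) {K : ℝ}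
    (hK : HasShortSums A K) {N : ℕ} (hN : ((d : ℝ) + 1) * kappa A * K ≤ N) : StructureEq A N := by
  refine Set.Subset.antisymm (nfold_subset hA N) ?_
  rintro v ⟨⟨y, hy, hyv⟩, hv⟩
  obtain ⟨a, ha, hay⟩ := exists_ex_heavy hy
  have haA := ex_subset A ha
  have h0B : (0 : Fin d → ℤ) ∈ reflect a A := mem_reflect.2 ⟨a, haA, sub_self a⟩
  set e := N • a - v with he
  have hyv' : (N : ℝ) • y = toReal v := hyv
  have hee : toReal e = (N : ℝ) • (toReal a - y) := by
    rw [he, toReal_sub, toReal_nsmul, ← hyv', smul_sub]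
  have hcone : toReal e ∈ cone (reflect a A) := by
    obtain ⟨c, hc, hc'⟩ := mem_cone_of_mem_hull_insert (E := reflect a A) (p := toReal a - y) (by
      rw [Finset.insert_eq_of_mem h0B, hull_reflect]
      exact ⟨y, hy, rfl⟩)
    refine ⟨fun b => N * c b, fun b hb => mul_nonneg (Nat.cast_nonneg _) (hc b hb), ?_⟩
    rw [hee, hc', Finset.smul_sum]
    exact Finset.sum_congr rfl fun b _ => (mul_smul _ _ _).symm
  have hsemi : e ∈ semigroup (reflect a A) := by
    by_contra hcon
    refine hv ?_
    simp only [Set.mem_iUnion]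
    exact ⟨a, ha, e, ⟨hcone, hcon⟩, by simp [he]⟩
  simp only [semigroup, Set.mem_iUnion] at hsemi
  obtain ⟨M, -, hM⟩ := hsemi
  obtain ⟨s, -, hs, hsum⟩ := mem_nfold_iff.1 hM
  obtain ⟨s', hs', hsum', φ, hφ, hcard⟩ := hK a ha s hs
  have hφe : φ (toReal s.sum) ≤ N * (1 - 1 / ((d : ℝ) + 1)) := by
    rw [hsum, hee, map_smul, smul_eq_mul]
    exact mul_le_mul_of_nonneg_left (hay φ hφ) (Nat.cast_nonneg _)
  have hle : s'.card ≤ N := by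
    have h1 : kappa A * K ≤ N * (1 / ((d : ℝ) + 1)) := by
      rw [mul_one_div, le_div_iff₀ (by positivity)]
      linarith
    have : (s'.card : ℝ) ≤ N := by linarith
    exact_mod_cast this
  -- Padding with zeros to exactly `N` terms; under b ↦ a - b the zeros become copies of `a`.
  refine mem_nfold_iff.2 ⟨(s' + Multiset.replicate (N - s'.card) 0).map fun b => a - b, ?_, ?_, ?_⟩
  · rw [Multiset.card_map, Multiset.card_add, Multiset.card_replicate]
    omega
  · intro b hb
    obtain ⟨c, hc, rfl⟩ := Multiset.mem_map.1 hb
    rcases Multiset.mem_add.1 hc with h | h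
    · exact sub_mem_of_mem_reflect (hs' c h)
    · rw [Multiset.eq_of_mem_replicate h]
      simpa using haA
  · rw [Multiset.sum_map_sub, Multiset.map_const', Multiset.map_id', Multiset.sum_replicate,
      Multiset.sum_add, Multiset.sum_replicate, smul_zero, add_zero, hsum', hsum,
      Multiset.card_add, Multiset.card_replicate, Nat.add_sub_cancel' hle, he]
    abel

/-- The candidate threshold is ⌊X⌋, and N ≥ ⌊X⌋ only gives X < N + 1. So (d+1)κK must undercut X by
1 or be harmless for another reason; the terms D - 1 and d! Vol - 1 were kept for this. -/
theorem NStr_le_of_hasShortSums {A : Finset (Fin d → ℤ)} (hA : A.Nonempty) {K X : ℝ}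
    (hK : HasShortSums A K) (hX : 0 ≤ X)
    (hKX : ∀ N : ℕ, X < N + 1 → ((d : ℝ) + 1) * kappa A * K ≤ N) :
    (∀ N : ℕ, NStr A ≤ N → StructureEq A N) ∧ (NStr A : ℝ) ≤ X := by
  have hmem : ⌊X⌋₊ ∈ {M : ℕ | ∀ N : ℕ, M ≤ N → StructureEq A N} := fun N hN =>
    hK.structureEq hA (hKX N (by exact_mod_cast Nat.lt_of_floor_lt (Nat.lt_succ_of_le hN)))
  refine ⟨Nat.sInf_mem ⟨_, hmem⟩, ?_⟩
  exact (Nat.cast_le.2 (Nat.sInf_le hmem)).trans (Nat.floor_le hX)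

theorem dim_add_one_le_card {E : Finset (Fin d → ℤ)} (h0 : 0 ∈ E)
    (hE : Submodule.span ℝ (toReal '' (E : Set (Fin d → ℤ))) = ⊤) : d + 1 ≤ E.card := by
  have h1 : Submodule.span ℝ (((E.erase 0).image toReal : Finset _) : Set (Fin d → ℝ)) = ⊤ := by
    rw [← hE, Finset.coe_image, Finset.coe_erase]
    conv_rhs => rw [← Set.insert_sdiff_self_of_mem (Finset.mem_coe.2 h0), Set.image_insert_eq,
      toReal_zero, Submodule.span_insert_zero]
  have h2 := finrank_span_finset_le_card (R := ℝ) ((E.erase 0).image toReal)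
  rw [Set.finrank, h1, finrank_top, Module.finrank_fin_fun] at h2
  have h3 := Finset.card_erase_add_one h0
  have h4 : ((E.erase 0).image toReal).card ≤ (E.erase 0).card := Finset.card_image_le
  omega

theorem dim_add_one_le_card_ex {A : Finset (Fin d → ℤ)} (h0 : 0 ∈ ex A)
    (hA : AddSubgroup.closure (A : Set (Fin d → ℤ)) = ⊤) : d + 1 ≤ (ex A).card := by
  have h0E : (0 : Fin d → ℤ) ∈ reflect 0 (ex A) := mem_reflect.2 ⟨0, h0, sub_self 0⟩
  refine (dim_add_one_le_card h0E (span_eq_top_of_subset_hull (B := reflect 0 A) (fun b hb => ?_)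
    (span_reflect_eq_top (ex_subset A h0) hA))).trans Finset.card_image_le
  rw [Finset.insert_eq_of_mem h0E, hull_reflect, hull_ex, ← hull_reflect]
  exact subset_convexHull ℝ _ ⟨b, hb, rfl⟩

end Sumset

theorem theorem1p5 (d : ℕ) (A : Finset (Fin d → ℤ))
    (h0 : (0 : Fin d → ℤ) ∈ Sumset.ex A)
    (hA : AddSubgroup.closure (A : Set (Fin d → ℤ)) = ⊤) :
    (∀ N : ℕ, Sumset.NStr A ≤ N → Sumset.StructureEq A N) ∧
    (Sumset.NStr A : ℝ) ≤
      ((d : ℝ) + 1) * Sumset.kappa A *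
        ((d.factorial : ℝ) * Sumset.vol A +
          (((Sumset.ex A).card : ℝ) - (d : ℝ) - 1) * (Sumset.volDagMax A : ℝ)) ∧
    (Sumset.NStr A : ℝ) ≤
      ((d : ℝ) + 1) * Sumset.kappa A *
        (((A.card : ℝ) - (d : ℝ) - 1) * (Sumset.volDagMax A : ℝ)) := by
  have h0A := Sumset.ex_subset A h0
  have hne : A.Nonempty := ⟨0, h0A⟩
  have hcardE := Sumset.dim_add_one_le_card_ex h0 hA
  have hcardA : d + 1 ≤ A.card := hcardE.trans (Finset.card_le_card (Sumset.ex_subset A))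
  have hE : (0 : ℝ) ≤ ((Sumset.ex A).card : ℝ) - d - 1 := by
    have : ((d + 1 : ℕ) : ℝ) ≤ (Sumset.ex A).card := by exact_mod_cast hcardE
    push_cast at this
    linarith
  have hD : (0 : ℝ) ≤ Sumset.volDagMax A := Nat.cast_nonneg _
  have hvol : 0 ≤ Sumset.vol A := ENNReal.toReal_nonneg
  have hκ : Sumset.kappa A = 0 ∨ 1 ≤ Sumset.kappa A := by
    rcases Nat.eq_zero_or_pos d with rfl | hd
    · exact Or.inl (Sumset.kappa_of_dim_zero A)
    · exact Or.inr (Sumset.one_le_kappa hd h0A hA)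
  have hmul : Sumset.kappa A = 0 ∨ 1 ≤ ((d : ℝ) + 1) * Sumset.kappa A :=
    hκ.imp_right fun h => one_le_mul_of_one_le_of_one_le (by simp) h
  have hmul0 : 0 ≤ ((d : ℝ) + 1) * Sumset.kappa A := by
    rcases hmul with h | h
    · simp [h]
    · linarith
  obtain ⟨hstr, hle1⟩ := Sumset.NStr_le_of_hasShortSums hne (Sumset.hasShortSums_ex h0A hA)
    (X := ((d : ℝ) + 1) * Sumset.kappa A * ((d.factorial : ℝ) * Sumset.vol A +
      (((Sumset.ex A).card : ℝ) - (d : ℝ) - 1) * (Sumset.volDagMax A : ℝ)))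
    (mul_nonneg hmul0 (by positivity)) (by
      intro N hN
      rcases hmul with h | h
      · simp [h]
      -- The bracket in X exceeds K by |ex(H(A))| - d ≥ 1, and the prefactor is at least 1.
      · have := mul_le_mul h (by linarith : 1 ≤ ((Sumset.ex A).card : ℝ) - d - 1 + 1) zero_le_one
          hmul0
        linarith)
  obtain ⟨-, hle2⟩ := Sumset.NStr_le_of_hasShortSums hne (Sumset.hasShortSums_card h0A hA)
    (X := ((d : ℝ) + 1) * Sumset.kappa A *
        (((A.card : ℝ) - (d : ℝ) - 1) * (Sumset.volDagMax A : ℝ)))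
    (mul_nonneg hmul0 (mul_nonneg (by
      have : ((d + 1 : ℕ) : ℝ) ≤ A.card := by exact_mod_cast hcardA
      push_cast at this
      linarith) hD)) (by
      intro N hN
      rcases hmul with h | h
      · simp [h]
      -- For |A| = d + 1 there is no saving, but K vanishes. Otherwise the bracket exceeds K by |A|
      -- - d - 1 ≥ 1.
      rcases hcardA.eq_or_lt with hc | hc
      · have : (A.card : ℝ) - d - 1 = 0 := by
          rw [← hc]
          push_cast
          ring
        rw [this]
        simp
      · have hc' : ((d + 1 + 1 : ℕ) : ℝ) ≤ A.card := by exact_mod_cast hc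
        push_cast at hc'
        have := mul_le_mul h (by linarith : 1 ≤ (A.card : ℝ) - d - 1) zero_le_one hmul0
        linarith)
  exact ⟨hstr, hle1, hle2⟩
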